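/- A mass is a Borel probability measure $\mu$ on $\mathbb R^2$ such that every line has $\mu$-measure zero. Let $\ell_1,\dots,\ell_q$ be distinct rays emanating from a point $O$, in counter-clockwise order, with indices taken modulo $q$. For $p<q$ let $W_i$ be the closed region swept by rotating $\ell_i$ counter-clockwise about $O$ until it reaches $\ell_{i+p}$; the family $W_1,\dots,W_q$ is called a $(q,p)$-spiral. It is a convex $(q,p)$-spiral equicovering of $\mu$ if every $W_i$ is convex, $\mu(W_i)=p/q$ for every $i$, and every point of the plane outside a finite union of lines lies in exactly $p$ of the sets $W_i$. Let $p$ and $q$ be coprime positive integers with $p<q$. 1. If $q<2p$, then there exists a mass that admits no convex $(q,p)$-spiral equicovering; in fact no mass admits one. 2. If $q<3p-3$, then there exists a mass that admits no convex $(q,p)$-spiral equicovering. 3. If $q=3p-3$ and $p$ is odd, then every mass admits a convex $(q,p)$-spiral equicovering. 4. If $3p-3<q<3p$ and $p\ge 2$, then every mass admits a convex $(q,p)$-spiral equicovering. 5. If $q\ge 3p$, then every mass admits a convex $(q,p)$-spiral equicovering. -/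

import Mathlib

noncomputable section

namespace SpiralEquicovering

open MeasureTheory

/-- The Euclidean plane. -/
abbrev Plane : Type := EuclideanSpace ℝ (Fin 2)

/-- A subset of the plane is a line if it is a one-dimensional affine subspace. -/
def IsLine (L : AffineSubspace ℝ Plane) : Prop := Module.finrank ℝ L.direction = 1

/-- A mass: a Borel probability measure on the plane for which every line is a null set. -/
def IsMass (μ : Measure Plane) : Prop :=
  IsProbabilityMeasure μ ∧ ∀ L : AffineSubspace ℝ Plane, IsLine L → μ (L : Set Plane) = 0

/-- The closed ray from `O` in the direction with polar angle `t`. -/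
def ray (O : Plane) (t : ℝ) : Set Plane :=
  {x | ∃ s : ℝ, 0 ≤ s ∧ x = O + s • (!₂[Real.cos t, Real.sin t] : Plane)}

/-- The region obtained by sweeping a ray about `O` counter-clockwise from angle `a` to angle
`b`. -/
def sweep (O : Plane) (a b : ℝ) : Set Plane := ⋃ t ∈ Set.Icc a b, ray O t

/-- A `k`-fan: `k` distinct rays emanating from a point, listed counter-clockwise. The indices
of the rays are taken modulo `k`; the angles are lifted to `ℝ`, so that they increase with the
index, and one full turn is made when the index grows by `k`. -/
structure Fan (k : ℕ) where
  center : Plane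
  angle : ℤ → ℝ
  angle_strictMono : StrictMono angle
  angle_add : ∀ i : ℤ, angle (i + (k : ℤ)) = angle i + 2 * Real.pi

/-- The `r`-wedge `W i`: the region swept counter-clockwise from the ray of index `i` to the ray
of index `i + r`. For `r = 1` it is the wedge between two consecutive rays. -/
def Fan.wedge {k : ℕ} (F : Fan k) (r : ℕ) (i : ℤ) : Set Plane :=
  sweep F.center (F.angle i) (F.angle (i + (r : ℤ)))

/-- The `(k, r)`-spiral of a `k`-fan: the family of its `k` `r`-wedges. -/
def Fan.spiral {k : ℕ} (F : Fan k) (r : ℕ) : Fin k → Set Plane :=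
  fun i => F.wedge r ((i : ℕ) : ℤ)

/-- A `(k, r)`-equicovering with respect to `μ`: `k` sets of the same measure such that every
point of the plane, except those on the union of finitely many lines, lies in exactly `r` of
them. -/
def IsEquicovering (μ : Measure Plane) {k : ℕ} (r : ℕ) (P : Fin k → Set Plane) : Prop :=
  (∀ i j : Fin k, μ (P i) = μ (P j)) ∧
  ∃ S : Set (AffineSubspace ℝ Plane), S.Finite ∧ (∀ L ∈ S, IsLine L) ∧
    ∀ x : Plane, (∀ L ∈ S, x ∉ L) → {i : Fin k | x ∈ P i}.ncard = r

/-- `μ` admits a convex `(q, p)`-spiral equicovering: some `(q, p)`-spiral is an equicovering,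
and all its members are convex and have measure `p / q`. -/
def AdmitsSpiralEquicovering (μ : Measure Plane) (q p : ℕ) : Prop :=
  ∃ F : Fan q, IsEquicovering μ p (F.spiral p) ∧
    ∀ i : Fin q, Convex ℝ (F.spiral p i) ∧ μ.real (F.spiral p i) = (p : ℝ) / (q : ℝ)

end SpiralEquicovering

end

/-! For coprime `p` and `q`, a convex spiral is the same thing as `q` rays cutting the mass into
sectors of mass `1 / q` such that any `p` consecutive sectors span at most a half-turn
(`AdmitsSpiralEquicovering.exists_isEquiFan`, `IsEquiFan.admits`).

Obstructions: `q` wedges laid end to end wind `p` times round the centre, so `2πp ≤ qπ`. Moreover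
every half-plane bounded by a line through the centre contains `p - 1` whole sectors. If `(p - 1) /
q > 1 / 3`, a mass spread over three small discs has no such centre.

Existence, for a mass charging every open set: the equal fans depend continuously on the centre `O`
and on a phase `s ∈ [0, 1]`, and `s = 1` gives the fan of `s = 0` with indices shifted by one.
Suppose each of them has a reflex wedge (wider than a half-turn). The sum of the bisectors of the
reflex wedges, with weights that vanish at width `π`, is a vector field in `O` that points outwards
far away, so its zeros have total degree one for each `s`. At a zero the open reflex wedges contain
all rays; two disjoint reflex wedges do not fit into a full turn, and counting indices in a cover by
three of them gives `q ≤ 3p - 3` (`reflex_cover`). This settles `q > 3p - 3` when `p ≥ 2`.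

If `q = 3p - 3`, exactly one triple of wedges spaced `p - 1` apart is reflex at a zero, so the
alternating sum of the triple excesses does not vanish there. For odd `p` it changes sign under the
index shift. The signed number of zeros where it is positive would be constant in `s`, yet pass from
`a` to `1 - a`, which no integer allows (`exists_zero_of_sign_reversal`, proved by a Sperner-type
labelling instead of degree theory).

An arbitrary mass is a limit of masses charging every open set, and compactness transfers the
spiral. The case `p = 1` follows from the pair `(2q, 2)`. -/

open MeasureTheory Filter Topology


/-! ### Sperner-type labelling of a square grid by residues modulo 3. -/

section
open Finset

namespace SpiralEquicovering

/-- The signed representative in `{-1, 0, 1}` of a residue modulo `3`. -/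
def signedRep (a : ZMod 3) : ℤ := if a = 0 then 0 else if a = 1 then 1 else -1

/-- The total turn of a labelling by residues modulo `3` around the unit square with lower left
corner `(i, j)`. -/
def squareTurn (L : ℕ → ℕ → ZMod 3) (i j : ℕ) : ℤ :=
  signedRep (L (i + 1) j - L i j) + signedRep (L (i + 1) (j + 1) - L (i + 1) j)
    - signedRep (L (i + 1) (j + 1) - L i (j + 1)) - signedRep (L i (j + 1) - L i j)

/-- With at most two labels, `signedRep` of a difference is itself a difference of potentials, so
the turn round a closed loop vanishes. -/
lemma squareTurn_ne_zero {L : ℕ → ℕ → ZMod 3} {i j : ℕ} (h : squareTurn L i j ≠ 0) (l : ZMod 3) :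
    l = L i j ∨ l = L (i + 1) j ∨ l = L (i + 1) (j + 1) ∨ l = L i (j + 1) := by
  have key : ∀ a b c d l : ZMod 3, signedRep (b - a) + signedRep (c - b) - signedRep (c - d)
      - signedRep (d - a) ≠ 0 → l = a ∨ l = b ∨ l = c ∨ l = d := by decide
  exact key _ _ _ _ l h

/-- The failure of additivity of `signedRep` along an edge with labels `a, b` that are changed to
`a', b'`. -/
def edgeDefect (a b a' b' : ZMod 3) : ℤ :=
  signedRep (b' - a') - signedRep (b - a) - signedRep (b' - b) + signedRep (a' - a)

/-- By oddness of `signedRep`, the defect is the turn round the loop `a → a' → b' → b → a`, the wall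
swept out by the edge between two times; two labels again force it to vanish. -/
lemma edgeDefect_ne_zero {a b a' b' : ZMod 3} (h : edgeDefect a b a' b' ≠ 0) (l : ZMod 3) :
    l = a ∨ l = b ∨ l = a' ∨ l = b' := by
  have key : ∀ a b a' b' l : ZMod 3, edgeDefect a b a' b' ≠ 0 →
      l = a ∨ l = b ∨ l = a' ∨ l = b' := by decide
  exact key _ _ _ _ l h

lemma edgeDefect_self (a b : ZMod 3) : edgeDefect a b a b = 0 := by
  revert a b; decide

/-- A discrete Green formula: every interior edge is traversed once in each direction. -/
lemma sum_squareTurn (L : ℕ → ℕ → ZMod 3) (N : ℕ) :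
    ∑ i ∈ range N, ∑ j ∈ range N, squareTurn L i j =
      ∑ i ∈ range N, signedRep (L (i + 1) 0 - L i 0)
      + ∑ j ∈ range N, signedRep (L N (j + 1) - L N j)
      - ∑ i ∈ range N, signedRep (L (i + 1) N - L i N)
      - ∑ j ∈ range N, signedRep (L 0 (j + 1) - L 0 j) := by
  have h1 : ∑ i ∈ range N, ∑ j ∈ range N,
      (signedRep (L (i + 1) (j + 1) - L i (j + 1)) - signedRep (L (i + 1) j - L i j)) =
      ∑ i ∈ range N, (signedRep (L (i + 1) N - L i N) - signedRep (L (i + 1) 0 - L i 0)) :=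
    sum_congr rfl fun i _ ↦ sum_range_sub (fun j ↦ signedRep (L (i + 1) j - L i j)) N
  have h2 : ∑ i ∈ range N, ∑ j ∈ range N,
      (signedRep (L (i + 1) (j + 1) - L (i + 1) j) - signedRep (L i (j + 1) - L i j)) =
      ∑ j ∈ range N, (signedRep (L N (j + 1) - L N j) - signedRep (L 0 (j + 1) - L 0 j)) := by
    rw [sum_comm]
    exact sum_congr rfl fun j _ ↦ sum_range_sub (fun i ↦ signedRep (L i (j + 1) - L i j)) N
  have h3 : ∑ i ∈ range N, ∑ j ∈ range N, squareTurn L i j =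
      ∑ i ∈ range N, ∑ j ∈ range N,
        (signedRep (L (i + 1) (j + 1) - L (i + 1) j) - signedRep (L i (j + 1) - L i j)) -
      ∑ i ∈ range N, ∑ j ∈ range N,
        (signedRep (L (i + 1) (j + 1) - L i (j + 1)) - signedRep (L (i + 1) j - L i j)) := by
    rw [← sum_sub_distrib]
    refine sum_congr rfl fun i _ ↦ ?_
    rw [← sum_sub_distrib]
    refine sum_congr rfl fun j _ ↦ ?_
    unfold squareTurn; ring
  rw [h3, h1, h2, sum_sub_distrib, sum_sub_distrib]; ring

/-- The labels that occur on the boundary of a square centred at the origin when the plane is cut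
into the three regions of `planeLabel` have total turn `3`. -/
lemma sum_squareTurn_eq_three {L : ℕ → ℕ → ZMod 3} {N : ℕ}
    (hB : ∀ i ≤ N, L i 0 = 0) (hR : ∀ j ≤ N, L N j = 0 ∨ L N j = 1)
    (hT : ∀ i ≤ N, L i N = 1 ∨ L i N = 2) (hl : ∀ j ≤ N, L 0 j = 0 ∨ L 0 j = 2)
    (hTR : L N N = 1) (hTL : L 0 N = 2) :
    ∑ i ∈ range N, ∑ j ∈ range N, squareTurn L i j = 3 := by
  -- Each side of the square carries only two labels, so its turn telescopes to the endpoints. For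
  -- the labels `1, 2` of the top side the potential has to be based at `1`.
  have e1 : ∀ a b : ZMod 3, (a = 0 ∨ a = 1) → (b = 0 ∨ b = 1) →
      signedRep (b - a) = signedRep b - signedRep a := by decide
  have e2 : ∀ a b : ZMod 3, (a = 1 ∨ a = 2) → (b = 1 ∨ b = 2) →
      signedRep (b - a) = signedRep (b - 1) - signedRep (a - 1) := by decide
  have e3 : ∀ a b : ZMod 3, (a = 0 ∨ a = 2) → (b = 0 ∨ b = 2) →
      signedRep (b - a) = signedRep b - signedRep a := by decide
  have s1 : ∑ i ∈ range N, signedRep (L (i + 1) 0 - L i 0) = 0 := by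
    refine sum_eq_zero fun i hi ↦ ?_
    have := mem_range.1 hi
    rw [hB i (by omega), hB (i + 1) (by omega)]; decide
  have s2 : ∑ j ∈ range N, signedRep (L N (j + 1) - L N j) = 1 := by
    rw [sum_congr rfl (g := fun j ↦ signedRep (L N (j + 1)) - signedRep (L N j)),
      sum_range_sub (fun j ↦ signedRep (L N j)), hTR, hB N le_rfl]
    · decide
    · intro j hj
      have := mem_range.1 hj
      exact e1 _ _ (hR j (by omega)) (hR (j + 1) (by omega))
  have s3 : ∑ i ∈ range N, signedRep (L (i + 1) N - L i N) = -1 := by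
    rw [sum_congr rfl (g := fun i ↦ signedRep (L (i + 1) N - 1) - signedRep (L i N - 1)),
      sum_range_sub (fun i ↦ signedRep (L i N - 1)), hTR, hTL]
    · decide
    · intro j hj
      have := mem_range.1 hj
      exact e2 _ _ (hT j (by omega)) (hT (j + 1) (by omega))
  have s4 : ∑ j ∈ range N, signedRep (L 0 (j + 1) - L 0 j) = -1 := by
    rw [sum_congr rfl (g := fun j ↦ signedRep (L 0 (j + 1)) - signedRep (L 0 j)),
      sum_range_sub (fun j ↦ signedRep (L 0 j)), hTL, hB 0 (by omega)]
    · decide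
    · intro j hj
      have := mem_range.1 hj
      exact e3 _ _ (hl j (by omega)) (hl (j + 1) (by omega))
  rw [sum_squareTurn, s1, s2, s3, s4]; norm_num

/-- Relabelling does not change a weighted total turn if the weight is locally constant where all
three labels occur close to each other. -/
lemma sum_weighted_squareTurn_congr {L L' : ℕ → ℕ → ZMod 3} {N : ℕ} (χ : ℕ → ℕ → ℤ)
    (hbd : ∀ i j, i ≤ N → j ≤ N → (i = 0 ∨ i = N ∨ j = 0 ∨ j = N) → L i j = L' i j)
    (hH : ∀ i < N, ∀ j < N, (∀ l, l = L i (j + 1) ∨ l = L (i + 1) (j + 1) ∨ l = L' i (j + 1) ∨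
      l = L' (i + 1) (j + 1)) → χ i j = χ i (j + 1))
    (hV : ∀ i < N, ∀ j < N, (∀ l, l = L (i + 1) j ∨ l = L (i + 1) (j + 1) ∨ l = L' (i + 1) j ∨
      l = L' (i + 1) (j + 1)) → χ i j = χ (i + 1) j) :
    ∑ i ∈ range N, ∑ j ∈ range N, χ i j * squareTurn L' i j =
      ∑ i ∈ range N, ∑ j ∈ range N, χ i j * squareTurn L i j := by
  let KH : ℕ → ℕ → ℤ := fun i j ↦ edgeDefect (L i j) (L (i + 1) j) (L' i j) (L' (i + 1) j)
  let KV : ℕ → ℕ → ℤ := fun i j ↦ edgeDefect (L i j) (L i (j + 1)) (L' i j) (L' i (j + 1))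
  -- The turn of a cell changes by the turns of its four walls. The weights on both sides of a wall
  -- agree whenever its turn is nonzero, so the weighted changes telescope.
  have hdiff : ∀ i ∈ range N, ∀ j ∈ range N,
      χ i j * squareTurn L' i j - χ i j * squareTurn L i j =
      (χ (i + 1) j * KV (i + 1) j - χ i j * KV i j)
        - (χ i (j + 1) * KH i (j + 1) - χ i j * KH i j) := by
    intro i hi j hj
    have e1 : χ i (j + 1) * KH i (j + 1) = χ i j * KH i (j + 1) := by
      by_cases h : KH i (j + 1) = 0
      · simp [h]
      · rw [hH i (mem_range.1 hi) j (mem_range.1 hj) (edgeDefect_ne_zero h)]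
    have e2 : χ (i + 1) j * KV (i + 1) j = χ i j * KV (i + 1) j := by
      by_cases h : KV (i + 1) j = 0
      · simp [h]
      · rw [hV i (mem_range.1 hi) j (mem_range.1 hj) (edgeDefect_ne_zero h)]
    rw [e1, e2]
    simp only [KH, KV, edgeDefect, squareTurn]; ring
  rw [← sub_eq_zero, ← sum_sub_distrib]
  simp_rw [← sum_sub_distrib]
  rw [sum_congr rfl fun i hi ↦ sum_congr rfl (hdiff i hi)]
  -- Only walls over the boundary survive, and there the labels do not change.
  have z1 : ∑ i ∈ range N, ∑ j ∈ range N, (χ (i + 1) j * KV (i + 1) j - χ i j * KV i j) = 0 := by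
    rw [sum_comm]
    refine sum_eq_zero fun j hj ↦ ?_
    have := mem_range.1 hj
    rw [sum_range_sub (fun i ↦ χ i j * KV i j)]
    simp only [KV]
    rw [hbd N j (by omega) (by omega) (by simp), hbd N (j + 1) (by omega) (by omega) (by simp),
      hbd 0 j (by omega) (by omega) (by simp), hbd 0 (j + 1) (by omega) (by omega) (by simp),
      edgeDefect_self, edgeDefect_self]
    simp
  have z2 : ∑ i ∈ range N, ∑ j ∈ range N, (χ i (j + 1) * KH i (j + 1) - χ i j * KH i j) = 0 := by
    refine sum_eq_zero fun i hi ↦ ?_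
    have := mem_range.1 hi
    rw [sum_range_sub (fun j ↦ χ i j * KH i j)]
    simp only [KH]
    rw [hbd i N (by omega) (by omega) (by simp), hbd (i + 1) N (by omega) (by omega) (by simp),
      hbd i 0 (by omega) (by omega) (by simp), hbd (i + 1) 0 (by omega) (by omega) (by simp),
      edgeDefect_self, edgeDefect_self]
    simp
  simp_rw [sum_sub_distrib] at z1 z2 ⊢
  linarith

/-- A decomposition of the plane into three regions that meet only at the origin. -/
noncomputable def planeLabel (x y : ℝ) : ZMod 3 := if y < 0 then 0 else if 0 ≤ x then 1 else 2

lemma planeLabel_eq_zero {x y : ℝ} (h : y < 0) : planeLabel x y = 0 := by simp [planeLabel, h]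

lemma planeLabel_eq_one {x y : ℝ} (h : 0 ≤ y) (hx : 0 ≤ x) : planeLabel x y = 1 := by
  simp [planeLabel, h.not_gt, hx]

lemma planeLabel_eq_two {x y : ℝ} (h : 0 ≤ y) (hx : x < 0) : planeLabel x y = 2 := by
  simp [planeLabel, h.not_gt, hx.not_ge]

lemma neg_of_planeLabel_eq_zero {x y : ℝ} (h : 0 = planeLabel x y) : y < 0 := by
  unfold planeLabel at h
  split_ifs at h with h1 h2
  · exact h1
  · exact absurd h (by decide)
  · exact absurd h (by decide)

lemma nonneg_of_planeLabel_eq_one {x y : ℝ} (h : 1 = planeLabel x y) : 0 ≤ x ∧ 0 ≤ y := by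
  unfold planeLabel at h
  split_ifs at h with h1 h2
  · exact absurd h (by decide)
  · exact ⟨h2, not_lt.1 h1⟩
  · exact absurd h (by decide)

lemma neg_of_planeLabel_eq_two {x y : ℝ} (h : 2 = planeLabel x y) : x < 0 := by
  unfold planeLabel at h
  split_ifs at h with h1 h2
  · exact absurd h (by decide)
  · exact absurd h (by decide)
  · exact not_le.1 h2

end SpiralEquicovering

end

/-! ### Signed counting of zeros in a one-parameter family of plane maps. -/

section
open Finset

namespace SpiralEquicovering

/-- A family `(f, g)` of plane maps over `s ∈ [0, 1]`, equal to the identity far out and closing up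
at `s = 1`, has for some `s` a zero at which `w` vanishes if `w` changes sign from `s = 0` to
`s = 1`. -/
theorem exists_zero_of_sign_reversal {f g w : ℝ × ℝ × ℝ → ℝ} (hf : Continuous f)
    (hg : Continuous g) (hw : Continuous w) {M : ℝ} (hM : 0 < M)
    (hfix : ∀ x y s, s ∈ Set.Icc (0 : ℝ) 1 → M ≤ |x| ∨ M ≤ |y| → f (x, y, s) = x ∧ g (x, y, s) = y)
    (hper : ∀ x y, f (x, y, 1) = f (x, y, 0) ∧ g (x, y, 1) = g (x, y, 0))
    (hsgn : ∀ x y, w (x, y, 1) = -w (x, y, 0)) :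
    ∃ x y s, s ∈ Set.Icc (0 : ℝ) 1 ∧ f (x, y, s) = 0 ∧ g (x, y, s) = 0 ∧ w (x, y, s) = 0 := by
  by_contra! hne
  let K : Set (ℝ × ℝ × ℝ) := Set.Icc (-M) M ×ˢ Set.Icc (-M) M ×ˢ Set.Icc (0 : ℝ) 1
  have hK : IsCompact K := isCompact_Icc.prod (isCompact_Icc.prod isCompact_Icc)
  have hKne : K.Nonempty := ⟨(0, 0, 0), by simp [K, hM.le]⟩
  -- By compactness the absence of common zeros is quantitative: where `|f|` and `|g|` are below
  -- `ε`, `|w|` is at least `ε`.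
  obtain ⟨p₀, hp₀, hmin⟩ := hK.exists_isMinOn hKne
    (f := fun p ↦ max (max |f p| |g p|) |w p|) (by fun_prop)
  set ε := max (max |f p₀| |g p₀|) |w p₀| with hε
  have hεpos : 0 < ε := by
    by_contra! h
    have h1 : |f p₀| ≤ 0 := (le_max_left _ _).trans ((le_max_left _ _).trans h)
    have h2 : |g p₀| ≤ 0 := (le_max_right _ _).trans ((le_max_left _ _).trans h)
    have h3 : |w p₀| ≤ 0 := (le_max_right _ _).trans h
    obtain ⟨x, y, s⟩ := p₀
    exact hne x y s hp₀.2.2 (abs_nonpos_iff.1 h1) (abs_nonpos_iff.1 h2) (abs_nonpos_iff.1 h3)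
  have hwε : ∀ p ∈ K, |f p| < ε → |g p| < ε → ε ≤ |w p| := by
    intro p hp h1 h2
    have h := isMinOn_iff.1 hmin p hp
    by_contra! h3
    exact absurd (max_lt (max_lt h1 h2) h3) h.not_gt
  have huc : ∀ {F : ℝ × ℝ × ℝ → ℝ}, Continuous F → ∃ δ > 0, ∀ p ∈ K, ∀ p' ∈ K, dist p p' < δ →
      |F p - F p'| < ε / 2 := fun {F} hF ↦ by
    have := Metric.uniformContinuousOn_iff.1 (hK.uniformContinuousOn_of_continuous hF.continuousOn)
      (ε / 2) (by positivity)
    simpa only [Real.dist_eq] using this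
  obtain ⟨δ₁, hδ₁, h₁⟩ := huc hf
  obtain ⟨δ₂, hδ₂, h₂⟩ := huc hg
  obtain ⟨δ₃, hδ₃, h₃⟩ := huc hw
  -- Two grid steps have length `4M / n` in space and `2 / n` in time; both must stay below `δ`.
  obtain ⟨n, hn⟩ := exists_nat_gt (max 1 ((4 * M + 2) / min δ₁ (min δ₂ δ₃)))
  set δ := min δ₁ (min δ₂ δ₃) with hδ
  have hδpos : 0 < δ := lt_min hδ₁ (lt_min hδ₂ hδ₃)
  have hn1 : (1 : ℝ) < n := (le_max_left _ _).trans_lt hn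
  have hn0 : (0 : ℝ) < n := by linarith
  have hn2 : (4 * M + 2) / n < δ := by
    rw [div_lt_iff₀ hn0, ← div_lt_iff₀' hδpos]
    exact (le_max_right _ _).trans_lt hn
  let c : ℕ → ℝ := fun i ↦ -M + 2 * M * (i / n)
  let P : ℕ → ℕ → ℕ → ℝ × ℝ × ℝ := fun k i j ↦ (c i, c j, (k : ℝ) / n)
  have hfrac : ∀ i ≤ n, (i : ℝ) / n ∈ Set.Icc (0 : ℝ) 1 := fun i hi ↦
    ⟨by positivity, by rw [div_le_one hn0]; exact_mod_cast hi⟩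
  have hc : ∀ i ≤ n, c i ∈ Set.Icc (-M) M := by
    intro i hi
    obtain ⟨h1, h2⟩ := hfrac i hi
    constructor <;> simp only [c] <;> nlinarith
  have hc0 : c 0 = -M := by simp [c]
  have hcn : c n = M := by simp only [c]; rw [div_self hn0.ne']; ring
  have hPK : ∀ k ≤ n, ∀ i ≤ n, ∀ j ≤ n, P k i j ∈ K := fun k hk i hi j hj ↦
    ⟨hc i hi, hc j hj, hfrac k hk⟩
  have hcd : ∀ i i' : ℕ, i ≤ i' + 2 → i' ≤ i + 2 → |(i : ℝ) / n - i' / n| ≤ 2 / n := by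
    intro i i' h h'
    rw [← sub_div, abs_div, abs_of_pos hn0]
    gcongr
    rw [abs_le]
    have h1 : (i : ℝ) ≤ i' + 2 := by exact_mod_cast h
    have h2 : (i' : ℝ) ≤ i + 2 := by exact_mod_cast h'
    constructor <;> linarith
  have hcd' : ∀ i i' : ℕ, i ≤ i' + 2 → i' ≤ i + 2 → |c i - c i'| < δ := by
    intro i i' h h'
    have := hcd i i' h h'
    have e : c i - c i' = 2 * M * ((i : ℝ) / n - i' / n) := by simp only [c]; ring
    rw [e, abs_mul, abs_of_pos (by positivity)]
    calc 2 * M * |(i : ℝ) / n - i' / n| ≤ 2 * M * (2 / n) := by gcongr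
      _ ≤ (4 * M + 2) / n := by rw [mul_div_assoc', div_le_div_iff_of_pos_right hn0]; linarith
      _ < δ := hn2
  have hPd : ∀ k k' i i' j j' : ℕ, k ≤ k' + 2 → k' ≤ k + 2 → i ≤ i' + 2 → i' ≤ i + 2 →
      j ≤ j' + 2 → j' ≤ j + 2 → dist (P k i j) (P k' i' j') < δ := by
    intro k k' i i' j j' h1 h2 h3 h4 h5 h6
    simp only [P, Prod.dist_eq, Real.dist_eq]
    refine max_lt (hcd' i i' h3 h4) (max_lt (hcd' j j' h5 h6) ?_)
    refine (hcd k k' h1 h2).trans_lt (lt_of_le_of_lt ?_ hn2)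
    gcongr; linarith
  let lab : ℝ × ℝ × ℝ → ZMod 3 := fun p ↦ planeLabel (f p) (g p)
  -- Labels `0` and `1` close together force a sign change of `g`, labels `1` and `2` one of `f`; so
  -- both are small nearby and `w` is not.
  have hclose : ∀ p ∈ K, ∀ a₀ ∈ K, ∀ a₁ ∈ K, ∀ a₂ ∈ K, 0 = lab a₀ → 1 = lab a₁ → 2 = lab a₂ →
      dist a₁ a₀ < δ → dist a₁ a₂ < δ → dist p a₁ < δ → ε ≤ |w p| := by
    intro p hp a₀ ha₀ a₁ ha₁ a₂ ha₂ l₀ l₁ l₂ d₀ d₂ d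
    have b₀ := neg_of_planeLabel_eq_zero l₀
    obtain ⟨b₁, b₁'⟩ := nonneg_of_planeLabel_eq_one l₁
    have b₂ := neg_of_planeLabel_eq_two l₂
    have t₀ := abs_lt.1 (h₂ a₁ ha₁ a₀ ha₀ (d₀.trans_le ((min_le_right _ _).trans (min_le_left _ _))))
    have t₂ := abs_lt.1 (h₁ a₁ ha₁ a₂ ha₂ (d₂.trans_le (min_le_left _ _)))
    have t := abs_lt.1 (h₁ p hp a₁ ha₁ (d.trans_le (min_le_left _ _)))
    have t' := abs_lt.1 (h₂ p hp a₁ ha₁ (d.trans_le ((min_le_right _ _).trans (min_le_left _ _))))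
    refine hwε p hp (abs_lt.2 ⟨?_, ?_⟩) (abs_lt.2 ⟨?_, ?_⟩) <;> linarith [t₀.1, t₀.2, t₂.1, t₂.2,
      t.1, t.2, t'.1, t'.2]
  have hsame : ∀ p ∈ K, ∀ p' ∈ K, ε ≤ |w p| → dist p p' < δ → (0 < w p ↔ 0 < w p') := by
    intro p hp p' hp' h d
    have t := abs_lt.1 (h₃ p hp p' hp' (d.trans_le ((min_le_right _ _).trans (min_le_right _ _))))
    rcases le_abs.1 h with h | h <;> constructor <;> intro <;> linarith [t.1, t.2]
  let L : ℕ → ℕ → ℕ → ZMod 3 := fun k i j ↦ lab (P k i j)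
  let χ : ℕ → ℕ → ℕ → ℤ := fun k i j ↦ if 0 < w (P k i j) then 1 else 0
  have hχ : ∀ k i j k' i' j', (0 < w (P k i j) ↔ 0 < w (P k' i' j')) → χ k i j = χ k' i' j' := by
    intro k i j k' i' j' h
    simp only [χ, h]
  -- the weight is bounded away from zero near cells with three labels
  have hturn : ∀ k ≤ n, ∀ i < n, ∀ j < n, squareTurn (L k) i j ≠ 0 → ∀ k' ≤ n, k' ≤ k + 1 →
      k ≤ k' + 1 → ε ≤ |w (P k' i j)| := by
    intro k hk i hi j hj h k' hk' h1 h2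
    have key : ∀ l, ∃ i' j', l = L k i' j' ∧ i ≤ i' ∧ i' ≤ i + 1 ∧ j ≤ j' ∧ j' ≤ j + 1 := by
      intro l
      rcases squareTurn_ne_zero h l with e | e | e | e
      · exact ⟨_, _, e, by omega, by omega, by omega, by omega⟩
      · exact ⟨_, _, e, by omega, by omega, by omega, by omega⟩
      · exact ⟨_, _, e, by omega, by omega, by omega, by omega⟩
      · exact ⟨_, _, e, by omega, by omega, by omega, by omega⟩
    obtain ⟨i₀, j₀, e₀, _⟩ := key 0
    obtain ⟨i₁, j₁, e₁, _⟩ := key 1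
    obtain ⟨i₂, j₂, e₂, _⟩ := key 2
    refine hclose _ (hPK k' hk' i hi.le j hj.le) (P k i₀ j₀) (hPK _ hk _ (by omega) _ (by omega))
      (P k i₁ j₁) (hPK _ hk _ (by omega) _ (by omega)) (P k i₂ j₂)
      (hPK _ hk _ (by omega) _ (by omega)) e₀ e₁ e₂ ?_ ?_ ?_ <;> apply hPd <;> omega
  have hedge : ∀ k < n, ∀ i j a b : ℕ, i + a ≤ n → j + b ≤ n → a ≤ 1 → b ≤ 1 →
      (∀ l, ∃ k' i' j', l = L k' i' j' ∧ k ≤ k' ∧ k' ≤ k + 1 ∧ i ≤ i' ∧ i' ≤ i + 1 ∧ i' ≤ n ∧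
        j ≤ j' ∧ j' ≤ j + 1 ∧ j' ≤ n) → χ k i j = χ k (i + a) (j + b) := by
    intro k hk i j a b hi hj ha hb key
    obtain ⟨k₀, i₀, j₀, e₀, _⟩ := key 0
    obtain ⟨k₁, i₁, j₁, e₁, _⟩ := key 1
    obtain ⟨k₂, i₂, j₂, e₂, _⟩ := key 2
    have hi0 : i ≤ n := by omega
    have hj0 : j ≤ n := by omega
    refine hχ _ _ _ _ _ _ (hsame _ (hPK k hk.le i hi0 j hj0) _ (hPK k hk.le _ hi _ hj) ?_ ?_)
    · refine hclose _ (hPK k hk.le i hi0 j hj0) (P k₀ i₀ j₀)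
        (hPK _ (by omega) _ (by omega) _ (by omega))
        (P k₁ i₁ j₁) (hPK _ (by omega) _ (by omega) _ (by omega)) (P k₂ i₂ j₂)
        (hPK _ (by omega) _ (by omega) _ (by omega)) e₀ e₁ e₂ ?_ ?_ ?_ <;> apply hPd <;> omega
    · apply hPd <;> omega
  have hbdry : ∀ k ≤ n, ∀ i ≤ n, ∀ j ≤ n, (i = 0 ∨ i = n ∨ j = 0 ∨ j = n) →
      L k i j = planeLabel (c i) (c j) := by
    intro k hk i hi j hj h
    have : M ≤ |c i| ∨ M ≤ |c j| := by
      rcases h with rfl | rfl | rfl | rfl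
      · left; rw [hc0, abs_neg]; exact le_abs_self M
      · left; rw [hcn]; exact le_abs_self M
      · right; rw [hc0, abs_neg]; exact le_abs_self M
      · right; rw [hcn]; exact le_abs_self M
    obtain ⟨e1, e2⟩ := hfix (c i) (c j) (k / n) (hfrac k hk) this
    simp only [L, lab, P, e1, e2]
  have htotal : ∑ i ∈ range n, ∑ j ∈ range n, squareTurn (L 0) i j = 3 := by
    refine sum_squareTurn_eq_three ?_ ?_ ?_ ?_ ?_ ?_
    · intro i hi
      rw [hbdry 0 (by omega) i hi 0 (by omega) (by simp), hc0, planeLabel_eq_zero (by linarith)]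
    · intro j hj
      rw [hbdry 0 (by omega) n le_rfl j hj (by simp), hcn]
      rcases lt_or_ge (c j) 0 with h | h
      · exact Or.inl (planeLabel_eq_zero h)
      · exact Or.inr (planeLabel_eq_one h hM.le)
    · intro i hi
      rw [hbdry 0 (by omega) i hi n le_rfl (by simp), hcn]
      rcases lt_or_ge (c i) 0 with h | h
      · exact Or.inr (planeLabel_eq_two hM.le h)
      · exact Or.inl (planeLabel_eq_one hM.le h)
    · intro j hj
      rw [hbdry 0 (by omega) 0 (by omega) j hj (by simp), hc0]
      rcases lt_or_ge (c j) 0 with h | h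
      · exact Or.inl (planeLabel_eq_zero h)
      · exact Or.inr (planeLabel_eq_two h (by linarith))
    · rw [hbdry 0 (by omega) n le_rfl n le_rfl (by simp), hcn, planeLabel_eq_one hM.le hM.le]
    · rw [hbdry 0 (by omega) 0 (by omega) n le_rfl (by simp), hcn, hc0,
        planeLabel_eq_two hM.le (by linarith)]
  -- Three times the signed number of zeros with `w > 0` at time `k / n`.
  let S : ℕ → ℤ := fun k ↦ ∑ i ∈ range n, ∑ j ∈ range n, χ k i j * squareTurn (L k) i j
  have hstep : ∀ k < n, S (k + 1) = S k := by
    intro k hk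
    -- The weights are updated first: on a cell with nonzero turn the sign of `w` cannot flip within
    -- one time step. The labels are updated afterwards.
    have e : S (k + 1) = ∑ i ∈ range n, ∑ j ∈ range n, χ k i j * squareTurn (L (k + 1)) i j := by
      refine sum_congr rfl fun i hi ↦ sum_congr rfl fun j hj ↦ ?_
      have hi := mem_range.1 hi
      have hj := mem_range.1 hj
      by_cases h : squareTurn (L (k + 1)) i j = 0
      · simp [h]
      · congr 1
        refine hχ _ _ _ _ _ _ (hsame _ (hPK _ (by omega) _ hi.le _ hj.le) _
          (hPK _ (by omega) _ hi.le _ hj.le)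
          (hturn (k + 1) hk i hi j hj h (k + 1) hk (by omega) (by omega)) ?_)
        apply hPd <;> omega
    rw [e]
    refine sum_weighted_squareTurn_congr (χ k) ?_ ?_ ?_
    · intro i j hi hj h
      rw [hbdry k hk.le i hi j hj h, hbdry (k + 1) hk i hi j hj h]
    · intro i hi j hj h
      refine hedge k hk i j 0 1 (by omega) (by omega) (by omega) (by omega) fun l ↦ ?_
      rcases h l with e | e | e | e <;>
        exact ⟨_, _, _, e, by omega, by omega, by omega, by omega, by omega, by omega, by omega,
          by omega⟩
    · intro i hi j hj h
      refine hedge k hk i j 1 0 (by omega) (by omega) (by omega) (by omega) fun l ↦ ?_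
      rcases h l with e | e | e | e <;>
        exact ⟨_, _, _, e, by omega, by omega, by omega, by omega, by omega, by omega, by omega,
          by omega⟩
  have hS : ∀ k ≤ n, S k = S 0 := by
    intro k
    induction k with
    | zero => simp
    | succ k ih => exact fun hk ↦ (hstep k hk).trans (ih (by omega))
  have hP0 : ∀ i j, P 0 i j = (c i, c j, 0) := by simp [P]
  have hPn : ∀ i j, P n i j = (c i, c j, 1) := by simp [P, div_self hn0.ne']
  have hLn : L n = L 0 := by
    funext i j
    simp only [L, lab, hP0, hPn, (hper (c i) (c j)).1, (hper (c i) (c j)).2]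
  -- The last labelling equals the first, while the sign of `w` is reversed, so the weights on the
  -- relevant cells are complementary.
  have hend : S n = 3 - S 0 := by
    rw [← htotal, ← sum_sub_distrib]
    simp_rw [S, hLn]
    refine sum_congr rfl fun i hi ↦ ?_
    rw [← sum_sub_distrib]
    refine sum_congr rfl fun j hj ↦ ?_
    by_cases h : squareTurn (L 0) i j = 0
    · simp [h]
    · have hw0 := hturn 0 (by omega) i (mem_range.1 hi) j (mem_range.1 hj) h 0 (by omega) (by omega)
        (by omega)
      have hwn : w (P n i j) = - w (P 0 i j) := by rw [hP0, hPn, hsgn]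
      have : χ n i j = 1 - χ 0 i j := by
        simp only [χ, hwn]
        rcases le_abs.1 hw0 with h | h
        · rw [if_neg (by linarith), if_pos (by linarith)]; rfl
        · rw [if_pos (by linarith), if_neg (by linarith)]; rfl
      rw [this]; ring
  -- Now `2 * S 0 = 3`, impossible by parity.
  have := hS n le_rfl
  omega

end SpiralEquicovering

end

/-! ### Polar coordinates, rays and sectors. -/

namespace SpiralEquicovering

/-- The polar angle of `x` seen from `O`, in `(-π, π]`. -/
noncomputable def polarAngle (O x : Plane) : ℝ := Complex.arg ⟨x 0 - O 0, x 1 - O 1⟩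

/-- `x` lies at distance `r` from `O` in the direction `φ`. -/
def IsPolar (O x : Plane) (r φ : ℝ) : Prop :=
  0 < r ∧ x 0 - O 0 = r * Real.cos φ ∧ x 1 - O 1 = r * Real.sin φ

/-- The signed distance of `x` from the line through `O` with direction `t`; it is positive on
the left. -/
noncomputable def lineSide (O : Plane) (t : ℝ) (x : Plane) : ℝ :=
  Real.cos t * (x 1 - O 1) - Real.sin t * (x 0 - O 0)

/-- The line through `O` with direction `t`. -/
noncomputable def lineThrough (O : Plane) (t : ℝ) : AffineSubspace ℝ Plane :=
  AffineSubspace.mk' O (Submodule.span ℝ {(!₂[Real.cos t, Real.sin t] : Plane)})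

lemma plane_ext {x y : Plane} (h0 : x 0 = y 0) (h1 : x 1 = y 1) : x = y := by
  ext i; fin_cases i
  · exact h0
  · exact h1

lemma isLine_lineThrough (O : Plane) (t : ℝ) : IsLine (lineThrough O t) := by
  rw [IsLine, lineThrough, AffineSubspace.direction_mk']
  refine finrank_span_singleton fun h ↦ ?_
  have h0 : Real.cos t = 0 := by simpa using congrArg (fun v : Plane ↦ v 0) h
  have h1 : Real.sin t = 0 := by simpa using congrArg (fun v : Plane ↦ v 1) h
  have := Real.cos_sq_add_sin_sq t
  rw [h0, h1] at this
  norm_num at this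

lemma mem_lineThrough {O x : Plane} {t : ℝ} (h : lineSide O t x = 0) : x ∈ lineThrough O t := by
  rw [lineThrough, AffineSubspace.mem_mk', Submodule.mem_span_singleton]
  have hcs := Real.cos_sq_add_sin_sq t
  unfold lineSide at h
  refine ⟨(x 0 - O 0) * Real.cos t + (x 1 - O 1) * Real.sin t, plane_ext ?_ ?_⟩
  · simp
    linear_combination (x 0 - O 0) * hcs + Real.sin t * h
  · simp
    linear_combination (x 1 - O 1) * hcs - Real.cos t * h

lemma exists_isPolar {O x : Plane} (h : x ≠ O) : ∃ r, IsPolar O x r (polarAngle O x) := by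
  set z : ℂ := ⟨x 0 - O 0, x 1 - O 1⟩ with hz
  have hz0 : z ≠ 0 := by
    intro h0
    apply h
    have h1 := congrArg Complex.re h0
    have h2 := congrArg Complex.im h0
    simp only [hz, Complex.zero_re, Complex.zero_im] at h1 h2
    exact plane_ext (by linarith) (by linarith)
  refine ⟨‖z‖, norm_pos_iff.2 hz0, ?_, ?_⟩
  · exact (Complex.norm_mul_cos_arg z).symm
  · exact (Complex.norm_mul_sin_arg z).symm

lemma IsPolar.lineSide {O x : Plane} {r φ : ℝ} (h : IsPolar O x r φ) (t : ℝ) :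
    lineSide O t x = r * Real.sin (φ - t) := by
  rw [SpiralEquicovering.lineSide, h.2.1, h.2.2, Real.sin_sub]; ring

lemma mem_ray_iff {O x : Plane} {t : ℝ} :
    x ∈ ray O t ↔ ∃ s, 0 ≤ s ∧ x 0 - O 0 = s * Real.cos t ∧ x 1 - O 1 = s * Real.sin t := by
  refine exists_congr fun s ↦ and_congr_right fun _ ↦ ⟨?_, ?_⟩
  · rintro rfl
    simp
  · rintro ⟨h0, h1⟩
    refine plane_ext ?_ ?_
    · simp; linarith
    · simp; linarith

lemma exists_int_of_cos_eq_sin_eq {a b : ℝ} (hc : Real.cos a = Real.cos b)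
    (hs : Real.sin a = Real.sin b) : ∃ k : ℤ, a = b + 2 * Real.pi * k := by
  have := Real.Angle.cos_sin_inj hc hs
  rw [Real.Angle.angle_eq_iff_two_pi_dvd_sub] at this
  obtain ⟨k, hk⟩ := this
  exact ⟨k, by linarith⟩

lemma IsPolar.mem_ray_iff {O x : Plane} {r φ : ℝ} (h : IsPolar O x r φ) {t : ℝ} :
    x ∈ ray O t ↔ ∃ k : ℤ, t = φ + 2 * Real.pi * k := by
  obtain ⟨hr, h0, h1⟩ := h
  rw [SpiralEquicovering.mem_ray_iff, h0, h1]
  constructor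
  · rintro ⟨s, hs, e0, e1⟩
    have : s ^ 2 = r ^ 2 := by
      have h1 := Real.cos_sq_add_sin_sq t
      have h2 := Real.cos_sq_add_sin_sq φ
      calc s ^ 2 = (s * Real.cos t) ^ 2 + (s * Real.sin t) ^ 2 := by linear_combination (-s^2) * h1
        _ = r ^ 2 := by rw [← e0, ← e1]; linear_combination (r^2) * h2
    have : s = r := by
      rcases sq_eq_sq_iff_eq_or_eq_neg.1 this with h | h <;> linarith
    subst this
    exact exists_int_of_cos_eq_sin_eq (mul_left_cancel₀ hr.ne' e0).symm
      (mul_left_cancel₀ hr.ne' e1).symm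
  · rintro ⟨k, rfl⟩
    refine ⟨r, hr.le, ?_, ?_⟩
    · rw [mul_comm (2 * Real.pi), Real.cos_add_int_mul_two_pi]
    · rw [mul_comm (2 * Real.pi), Real.sin_add_int_mul_two_pi]

lemma mem_sweep {O x : Plane} {a b : ℝ} : x ∈ sweep O a b ↔ ∃ t ∈ Set.Icc a b, x ∈ ray O t := by
  simp [sweep]

lemma IsPolar.mem_sweep_iff {O x : Plane} {r φ : ℝ} (h : IsPolar O x r φ) {a b : ℝ} :
    x ∈ sweep O a b ↔ ∃ k : ℤ, φ + 2 * Real.pi * k ∈ Set.Icc a b := by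
  rw [mem_sweep]
  constructor
  · rintro ⟨t, ht, hx⟩
    obtain ⟨k, rfl⟩ := h.mem_ray_iff.1 hx
    exact ⟨k, ht⟩
  · rintro ⟨k, hk⟩
    exact ⟨_, hk, h.mem_ray_iff.2 ⟨k, rfl⟩⟩

lemma center_mem_ray (O : Plane) (t : ℝ) : O ∈ ray O t := ⟨0, le_rfl, by simp⟩

lemma center_mem_sweep (O : Plane) {a b : ℝ} (h : a ≤ b) : O ∈ sweep O a b :=
  mem_sweep.2 ⟨a, ⟨le_rfl, h⟩, center_mem_ray O a⟩

lemma ray_add_int (O : Plane) (t : ℝ) (k : ℤ) : ray O (t + 2 * Real.pi * k) = ray O t := by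
  unfold ray
  rw [mul_comm (2 * Real.pi), Real.cos_add_int_mul_two_pi, Real.sin_add_int_mul_two_pi]

lemma sweep_add_int (O : Plane) (a b : ℝ) (k : ℤ) :
    sweep O (a + 2 * Real.pi * k) (b + 2 * Real.pi * k) = sweep O a b := by
  ext x
  simp only [mem_sweep]
  constructor
  · rintro ⟨t, ⟨h1, h2⟩, hx⟩
    refine ⟨t - 2 * Real.pi * k, ⟨by linarith, by linarith⟩, ?_⟩
    rwa [← ray_add_int _ _ k, sub_add_cancel]
  · rintro ⟨t, ⟨h1, h2⟩, hx⟩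
    refine ⟨t + 2 * Real.pi * k, ⟨by linarith, by linarith⟩, ?_⟩
    rwa [ray_add_int]

lemma sweep_full (O : Plane) (a : ℝ) : sweep O a (a + 2 * Real.pi) = Set.univ := by
  refine Set.eq_univ_of_forall fun x ↦ ?_
  have hpi := Real.pi_pos
  by_cases h : x = O
  · subst h; exact center_mem_sweep _ (by linarith)
  · obtain ⟨r, hr⟩ := exists_isPolar h
    rw [hr.mem_sweep_iff]
    obtain ⟨k, hk, _⟩ := existsUnique_add_zsmul_mem_Ico Real.two_pi_pos (polarAngle O x) a
    refine ⟨k, ?_⟩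
    simp only [zsmul_eq_mul] at hk
    exact ⟨by linarith [hk.1], by linarith [hk.2]⟩

lemma sweep_union (O : Plane) {a b c : ℝ} (h1 : a ≤ b) (h2 : b ≤ c) :
    sweep O a c = sweep O a b ∪ sweep O b c := by
  simp only [sweep]
  rw [← Set.biUnion_union, Set.Icc_union_Icc_eq_Icc h1 h2]

lemma sweep_mono (O : Plane) {a b c d : ℝ} (h1 : c ≤ a) (h2 : b ≤ d) :
    sweep O a b ⊆ sweep O c d :=
  Set.biUnion_subset_biUnion_left (Set.Icc_subset_Icc h1 h2)

/-- Lift the polar angle `φ` to `[a, a + 2π)`. If `φ > b`, the first inequality gives `φ ≤ a + π`,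
so `b - φ` lies in `(-π, 0)` and violates the second. -/
lemma mem_sweep_iff_lineSide {O x : Plane} {a b : ℝ} (hab : a < b) (hba : b ≤ a + Real.pi) :
    x ∈ sweep O a b ↔ 0 ≤ lineSide O a x ∧ lineSide O b x ≤ 0 := by
  have hpi := Real.pi_pos
  by_cases h : x = O
  · subst h; simp [center_mem_sweep _ hab.le, lineSide]
  obtain ⟨r, hr⟩ := exists_isPolar h
  obtain ⟨k, hk, _⟩ := existsUnique_add_zsmul_mem_Ico Real.two_pi_pos (polarAngle O x) a
  simp only [zsmul_eq_mul] at hk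
  set φ := polarAngle O x + k * (2 * Real.pi) with hφ
  have hr' : IsPolar O x r φ := by
    refine ⟨hr.1, ?_, ?_⟩
    · rw [hφ, Real.cos_add_int_mul_two_pi]; exact hr.2.1
    · rw [hφ, Real.sin_add_int_mul_two_pi]; exact hr.2.2
  rw [hr'.lineSide, hr'.lineSide, mul_nonneg_iff_of_pos_left hr.1,
    show r * Real.sin (φ - b) ≤ 0 ↔ 0 ≤ Real.sin (b - φ) by
      rw [← neg_sub φ b, Real.sin_neg, mul_nonpos_iff_pos_imp_nonpos]
      constructor
      · intro h; linarith [h.1 hr.1]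
      · intro h; exact ⟨fun _ ↦ by linarith, fun h' ↦ hr.1.le⟩,
    hr'.mem_sweep_iff]
  constructor
  · rintro ⟨l, hl1, hl2⟩
    have hl : l = 0 := by
      have h1 : (l : ℝ) < 1 := by
        by_contra! h
        nlinarith [hk.1]
      have h2 : (-1 : ℝ) < l := by
        by_contra! h
        nlinarith [hk.2]
      have h1' : l < 1 := by exact_mod_cast h1
      have h2' : -1 < l := by exact_mod_cast h2
      omega
    subst hl
    simp only [Int.cast_zero, mul_zero, add_zero] at hl1 hl2
    exact ⟨Real.sin_nonneg_of_nonneg_of_le_pi (by linarith) (by linarith),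
      Real.sin_nonneg_of_nonneg_of_le_pi (by linarith) (by linarith)⟩
  · rintro ⟨h1, h2⟩
    refine ⟨0, ?_⟩
    simp only [Int.cast_zero, mul_zero, add_zero]
    refine ⟨hk.1, ?_⟩
    by_contra! h3
    have h4 : φ - a ≤ Real.pi := by
      by_contra! h5
      have := Real.sin_pos_of_pos_of_lt_pi (x := φ - a - Real.pi) (by linarith) (by linarith [hk.2])
      rw [Real.sin_sub_pi] at this
      linarith
    have := Real.sin_neg_of_neg_of_neg_pi_lt (x := b - φ) (by linarith) (by linarith)
    linarith

lemma mem_halfPlane_iff {O x : Plane} {a : ℝ} :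
    x ∈ sweep O a (a + Real.pi) ↔ 0 ≤ lineSide O a x := by
  rw [mem_sweep_iff_lineSide (by linarith [Real.pi_pos]) le_rfl]
  simp [lineSide, Real.cos_add_pi, Real.sin_add_pi]

lemma convex_sweep (O : Plane) {a b : ℝ} (hab : a < b) (hba : b ≤ a + Real.pi) :
    Convex ℝ (sweep O a b) := by
  have : sweep O a b = {x | 0 ≤ lineSide O a x ∧ lineSide O b x ≤ 0} := by
    ext x; exact mem_sweep_iff_lineSide hab hba
  rw [this]
  intro x hx y hy s t hs ht hst
  have key : ∀ c, lineSide O c (s • x + t • y) = s * lineSide O c x + t * lineSide O c y := by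
    intro c
    simp only [lineSide, PiLp.add_apply, PiLp.smul_apply, smul_eq_mul]
    linear_combination (Real.cos c * O 1 - Real.sin c * O 0) * hst
  simp only [Set.mem_ofPred_eq, key]
  constructor
  · have := mul_nonneg hs hx.1
    have := mul_nonneg ht hy.1
    linarith
  · have := mul_nonneg hs (neg_nonneg.2 hx.2)
    have := mul_nonneg ht (neg_nonneg.2 hy.2)
    linarith

/-- For a reflex sector, the midpoint of the unit points on the two bounding rays lies opposite to
the bisector, outside the sector. -/
lemma le_add_pi_of_convex_sweep {O : Plane} {a b : ℝ} (hab : b < a + 2 * Real.pi)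
    (h : Convex ℝ (sweep O a b)) : b ≤ a + Real.pi := by
  by_contra! hlt
  have hpi := Real.pi_pos
  set m := (a + b) / 2 with hm
  set α := (b - a) / 2 with hα
  have ha : a = m - α := by rw [hm, hα]; ring
  have hb : b = m + α := by rw [hm, hα]; ring
  have hcos : 0 < -Real.cos α := by
    have := Real.cos_neg_of_pi_div_two_lt_of_lt (x := α) (by linarith) (by linarith)
    linarith
  have hpa : O + (1 : ℝ) • (!₂[Real.cos a, Real.sin a] : Plane) ∈ sweep O a b :=
    mem_sweep.2 ⟨a, ⟨le_rfl, by linarith⟩, 1, zero_le_one, rfl⟩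
  have hpb : O + (1 : ℝ) • (!₂[Real.cos b, Real.sin b] : Plane) ∈ sweep O a b :=
    mem_sweep.2 ⟨b, ⟨by linarith, le_rfl⟩, 1, zero_le_one, rfl⟩
  have hmid := h hpa hpb (a := 1 / 2) (b := 1 / 2) (by norm_num) (by norm_num) (by norm_num)
  have hpol : IsPolar O ((1 / 2 : ℝ) • (O + (1 : ℝ) • (!₂[Real.cos a, Real.sin a] : Plane))
      + (1 / 2 : ℝ) • (O + (1 : ℝ) • (!₂[Real.cos b, Real.sin b] : Plane)))
      (-Real.cos α) (m + Real.pi) := by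
    refine ⟨hcos, ?_, ?_⟩
    · simp
      rw [ha, hb, Real.cos_sub, Real.cos_add]; ring
    · simp
      rw [ha, hb, Real.sin_sub, Real.sin_add]; ring
  rw [hpol.mem_sweep_iff] at hmid
  obtain ⟨k, hk1, hk2⟩ := hmid
  rcases le_or_gt 0 k with h0 | h0
  · have : (0 : ℝ) ≤ k := by exact_mod_cast h0
    nlinarith
  · have : (k : ℝ) ≤ -1 := by exact_mod_cast (by omega : k ≤ -1)
    nlinarith

end SpiralEquicovering

/-! ### Masses of sectors and the angular distribution function. -/

namespace SpiralEquicovering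

lemma measurable_polarAngle_uncurry :
    Measurable fun p : Plane × Plane ↦ polarAngle p.1 p.2 := by
  unfold polarAngle
  refine Complex.measurable_arg.comp ?_
  have : Continuous fun p : Plane × Plane ↦
      ((p.2 0 - p.1 0 : ℝ) : ℂ) + ((p.2 1 - p.1 1 : ℝ) : ℂ) * Complex.I := by fun_prop
  convert this.measurable using 2 with p
  exact Complex.mk_eq_add_mul_I _ _

lemma measurable_polarAngle (O : Plane) : Measurable (polarAngle O) :=
  measurable_polarAngle_uncurry.comp measurable_prodMk_left

lemma measurableSet_sweep (O : Plane) {a b : ℝ} (h : a ≤ b) : MeasurableSet (sweep O a b) := by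
  have : sweep O a b = {O} ∪ ⋃ k : ℤ, {x | polarAngle O x + 2 * Real.pi * k ∈ Set.Icc a b} \ {O} := by
    ext x
    by_cases hx : x = O
    · subst hx; simp [center_mem_sweep _ h]
    · obtain ⟨r, hr⟩ := exists_isPolar hx
      rw [hr.mem_sweep_iff]
      simp [hx]
  rw [this]
  refine (measurableSet_singleton _).union (MeasurableSet.iUnion fun k ↦ ?_)
  exact (((measurable_polarAngle O).add_const _) measurableSet_Icc).diff (measurableSet_singleton _)

variable {μ : Measure Plane}

lemma IsMass.lineSide_eq_zero (h : IsMass μ) (O : Plane) (t : ℝ) :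
    μ {x | lineSide O t x = 0} = 0 :=
  measure_mono_null (fun _ hx ↦ mem_lineThrough hx) (h.2 _ (isLine_lineThrough O t))

lemma IsMass.ae_lineSide_ne_zero (h : IsMass μ) (O : Plane) (t : ℝ) :
    ∀ᵐ x ∂μ, lineSide O t x ≠ 0 := by
  rw [ae_iff]
  simpa using h.lineSide_eq_zero O t

lemma IsPolar.lineSide_eq_zero {O x : Plane} {r φ t : ℝ} (h : IsPolar O x r φ) (k : ℤ)
    (e : φ + 2 * Real.pi * k = t) : SpiralEquicovering.lineSide O t x = 0 := by
  have h2 : φ - t = ((-2 * k : ℤ) : ℝ) * Real.pi := by push_cast; linarith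
  rw [h.lineSide, h2, Real.sin_int_mul_pi, mul_zero]

/-- Within one full turn the two sectors overlap only on the lines in directions `b` and `a`, which
are null. -/
lemma IsMass.measureReal_sweep_add (h : IsMass μ) (O : Plane) {a b c : ℝ} (h1 : a ≤ b)
    (h2 : b ≤ c) (h3 : c ≤ a + 2 * Real.pi) :
    μ.real (sweep O a c) = μ.real (sweep O a b) + μ.real (sweep O b c) := by
  have := h.1
  have hpi := Real.pi_pos
  have hd : AEDisjoint μ (sweep O a b) (sweep O b c) := by
    refine measure_mono_null (t := {x | lineSide O b x = 0} ∪ {x | lineSide O a x = 0}) ?_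
      (measure_union_null (h.lineSide_eq_zero O b) (h.lineSide_eq_zero O a))
    rintro x ⟨hx1, hx2⟩
    by_cases hx : x = O
    · subst hx; left; simp [lineSide]
    · obtain ⟨r, hr⟩ := exists_isPolar hx
      rw [hr.mem_sweep_iff] at hx1 hx2
      obtain ⟨k, hk1, hk2⟩ := hx1
      obtain ⟨l, hl1, hl2⟩ := hx2
      rcases lt_trichotomy l k with hlk | rfl | hlk
      · have : (l : ℝ) + 1 ≤ k := by exact_mod_cast hlk
        exfalso
        nlinarith
      · left
        exact hr.lineSide_eq_zero l (le_antisymm hk2 hl1)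
      · have : (k : ℝ) + 1 ≤ l := by exact_mod_cast hlk
        right
        refine hr.lineSide_eq_zero k (le_antisymm ?_ hk1)
        nlinarith
  rw [sweep_union O h1 h2, measureReal_def, measure_union₀ (measurableSet_sweep O h2).nullMeasurableSet
    hd, ENNReal.toReal_add (measure_ne_top _ _) (measure_ne_top _ _)]
  rfl

/-- The mass of the points whose polar angle seen from `O` is at most `t`. -/
noncomputable def angularMass (μ : Measure Plane) (O : Plane) (t : ℝ) : ℝ :=
  μ.real {x | polarAngle O x ≤ t}

lemma measurableSet_polarAngle_le (O : Plane) (t : ℝ) : MeasurableSet {x | polarAngle O x ≤ t} :=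
  measurable_polarAngle O measurableSet_Iic

lemma polarAngle_mem (O x : Plane) : polarAngle O x ∈ Set.Ioc (-Real.pi) Real.pi :=
  Complex.arg_mem_Ioc _

lemma angularMass_neg_pi (μ : Measure Plane) (O : Plane) : angularMass μ O (-Real.pi) = 0 := by
  have : {x | polarAngle O x ≤ -Real.pi} = ∅ := by
    ext x; simpa using (polarAngle_mem O x).1
  rw [angularMass, this, measureReal_empty]

lemma angularMass_pi [IsProbabilityMeasure μ] (O : Plane) : angularMass μ O Real.pi = 1 := by
  have : {x | polarAngle O x ≤ Real.pi} = Set.univ :=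
    Set.eq_univ_of_forall fun x ↦ (polarAngle_mem O x).2
  rw [angularMass, this, probReal_univ]

lemma angularMass_mono [IsFiniteMeasure μ] (O : Plane) : Monotone (angularMass μ O) :=
  fun _ _ h ↦ measureReal_mono fun _ hx ↦ le_trans hx h

lemma IsMass.measureReal_sweep_neg_pi (h : IsMass μ) (O : Plane) (t : ℝ) :
    μ.real (sweep O (-Real.pi) t) = angularMass μ O t := by
  refine measureReal_congr ?_
  filter_upwards [h.ae_lineSide_ne_zero O (-Real.pi), h.ae_lineSide_ne_zero O t] with x hx hx'
  have hpi := Real.pi_pos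
  have hxO : x ≠ O := by
    rintro rfl
    simp [lineSide] at hx
  obtain ⟨r, hr⟩ := exists_isPolar hxO
  have hm := polarAngle_mem O x
  refine propext ?_
  change x ∈ sweep O (-Real.pi) t ↔ polarAngle O x ≤ t
  rw [hr.mem_sweep_iff]
  constructor
  · rintro ⟨k, hk1, hk2⟩
    rcases lt_trichotomy k 0 with h0 | rfl | h0
    · have : (k : ℝ) ≤ -1 := by exact_mod_cast (by omega : k ≤ -1)
      exact absurd (hr.lineSide_eq_zero k (le_antisymm (by nlinarith [hm.2]) hk1)) hx
    · simpa using hk2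
    · have : (1 : ℝ) ≤ k := by exact_mod_cast h0
      nlinarith [hm.1]
  · intro hle
    exact ⟨0, by simpa using ⟨hm.1.le, hle⟩⟩

lemma IsMass.measureReal_sweep (h : IsMass μ) (O : Plane) {a b : ℝ} (ha : -Real.pi ≤ a)
    (hab : a ≤ b) (hb : b ≤ Real.pi) :
    μ.real (sweep O a b) = angularMass μ O b - angularMass μ O a := by
  rw [← h.measureReal_sweep_neg_pi O b,
    ← h.measureReal_sweep_neg_pi O a, h.measureReal_sweep_add O ha hab (by linarith)]
  ring

/-- For `x` off the line in direction `t` through `O`, and off the horizontal line where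
`Complex.arg` may jump, `polarAngle O x ≤ t` is stable under small changes of `(O, t)`. The
indicators thus converge almost everywhere. -/
lemma IsMass.continuous_angularMass (h : IsMass μ) :
    Continuous fun p : Plane × ℝ ↦ angularMass μ p.1 p.2 := by
  have := h.1
  rw [continuous_iff_continuousAt]
  rintro ⟨O, t⟩
  have key : Tendsto (fun p : Plane × ℝ ↦ μ {x | polarAngle p.1 x ≤ p.2}) (𝓝 (O, t))
      (𝓝 (μ {x | polarAngle O x ≤ t})) := by
    refine tendsto_measure_of_ae_tendsto_indicator_of_isFiniteMeasure _
      (measurableSet_polarAngle_le O t) (fun p ↦ measurableSet_polarAngle_le p.1 p.2) ?_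
    filter_upwards [h.ae_lineSide_ne_zero O t, h.ae_lineSide_ne_zero O 0] with x hx hx'
    have hxO : x ≠ O := by
      rintro rfl
      simp [lineSide] at hx
    obtain ⟨r, hr⟩ := exists_isPolar hxO
    have hne : polarAngle O x ≠ t := fun e ↦ hx (hr.lineSide_eq_zero 0 (by simpa using e))
    have hc : ContinuousAt (fun p : Plane × ℝ ↦ polarAngle p.1 x) (O, t) := by
      unfold polarAngle
      refine ContinuousAt.comp (g := Complex.arg) (Complex.continuousAt_arg ?_) ?_
      · right
        simp [lineSide] at hx'
        exact hx'
      · have : Continuous fun p : Plane × ℝ ↦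
          ((x 0 - p.1 0 : ℝ) : ℂ) + ((x 1 - p.1 1 : ℝ) : ℂ) * Complex.I := by fun_prop
        convert this.continuousAt using 2 with p
        exact Complex.mk_eq_add_mul_I _ _
    rcases lt_or_gt_of_ne hne with hlt | hlt
    · filter_upwards [hc.eventually_lt continuousAt_snd hlt] with p hp
      exact iff_of_true hp.le hlt.le
    · filter_upwards [ContinuousAt.eventually_lt continuousAt_snd hc hlt] with p hp
      exact iff_of_false (not_le.2 hp) (not_le.2 hlt)
  exact (ENNReal.tendsto_toReal (measure_ne_top _ _)).comp key

/-- The points seen strictly between two directions contain a nonempty open set. -/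
lemma angularMass_strictMonoOn [IsFiniteMeasure μ] [μ.IsOpenPosMeasure] (O : Plane) :
    StrictMonoOn (angularMass μ O) (Set.Icc (-Real.pi) Real.pi) := by
  intro a ha b hb hab
  have hpi := Real.pi_pos
  let g : Plane → ℂ := fun x ↦ ((x 0 - O 0 : ℝ) : ℂ) + ((x 1 - O 1 : ℝ) : ℂ) * Complex.I
  have hg : Continuous g := by fun_prop
  have hpa : ∀ x, polarAngle O x = Complex.arg (g x) := fun x ↦
    congrArg Complex.arg (Complex.mk_eq_add_mul_I _ _)
  let U : Set Plane := g ⁻¹' (Complex.slitPlane ∩ Complex.arg ⁻¹' Set.Ioo a b)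
  have hU : IsOpen U := by
    refine IsOpen.preimage hg ?_
    exact ContinuousOn.isOpen_inter_preimage
      (fun z (hz : z ∈ Complex.slitPlane) ↦ (Complex.continuousAt_arg hz).continuousWithinAt) Complex.isOpen_slitPlane isOpen_Ioo
  have hUne : U.Nonempty := by
    set m := (a + b) / 2 with hm
    have hm1 : m ∈ Set.Ioc (-Real.pi) Real.pi := ⟨by linarith [ha.1], by linarith [hb.2]⟩
    have harg : Complex.arg (Complex.cos m + Complex.sin m * Complex.I) = m :=
      Complex.arg_cos_add_sin_mul_I hm1
    refine ⟨O + (!₂[Real.cos m, Real.sin m] : Plane), ?_⟩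
    have e : g (O + (!₂[Real.cos m, Real.sin m] : Plane)) = Complex.cos m + Complex.sin m * Complex.I := by
      simp [g]
    change g _ ∈ Complex.slitPlane ∩ Complex.arg ⁻¹' Set.Ioo a b
    rw [e]
    refine ⟨?_, ?_⟩
    · rw [Complex.mem_slitPlane_iff_arg, harg]
      refine ⟨by linarith [hb.2], fun h0 ↦ ?_⟩
      have h1 := congrArg Complex.re h0
      have h2 := congrArg Complex.im h0
      simp [-Complex.ofReal_cos, -Complex.ofReal_sin] at h1 h2
      rw [Complex.cos_ofReal_re] at h1
      rw [Complex.sin_ofReal_re] at h2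
      have := Real.cos_sq_add_sin_sq m
      rw [h1, h2] at this
      norm_num at this
    · change Complex.arg _ ∈ Set.Ioo a b
      rw [harg]
      exact ⟨by linarith, by linarith⟩
  have hdisj : Disjoint {x | polarAngle O x ≤ a} U := by
    rw [Set.disjoint_left]
    intro x hx hxU
    have h1 : a < Complex.arg (g x) := hxU.2.1
    rw [← hpa] at h1
    exact absurd h1 (not_lt.2 hx)
  have hsub : {x | polarAngle O x ≤ a} ∪ U ⊆ {x | polarAngle O x ≤ b} := by
    rintro x (hx | hx)
    · exact le_trans hx hab.le
    · have h1 : Complex.arg (g x) < b := hx.2.2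
      rw [← hpa] at h1
      exact h1.le
  have hpos : 0 < μ.real U := ENNReal.toReal_pos (hU.measure_pos μ hUne).ne' (measure_ne_top _ _)
  calc angularMass μ O a < μ.real {x | polarAngle O x ≤ a} + μ.real U := by
        unfold angularMass; linarith
    _ = μ.real ({x | polarAngle O x ≤ a} ∪ U) := (measureReal_union hdisj hU.measurableSet).symm
    _ ≤ angularMass μ O b := measureReal_mono hsub

end SpiralEquicovering

/-! ### Fans of equal sectors and their relation to convex spirals. -/

namespace SpiralEquicovering

lemma add_int_mul_of_add {q : ℕ} {θ : ℤ → ℝ} (h : ∀ i, θ (i + q) = θ i + 2 * Real.pi) (i k : ℤ) :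
    θ (i + q * k) = θ i + 2 * Real.pi * k := by
  induction k using Int.induction_on with
  | zero => simp
  | succ k ih =>
    have := h (i + q * k)
    rw [show i + q * ((k : ℤ) + 1) = i + q * k + q by ring, this, ih]
    push_cast; ring
  | pred k ih =>
    have := h (i + q * (-(k : ℤ) - 1))
    rw [show i + q * (-(k : ℤ) - 1) + q = i + q * (-(k : ℤ)) by ring, ih] at this
    push_cast at this ⊢
    linarith

lemma exists_index_le_lt {q : ℕ} {θ : ℤ → ℝ} (hθ : StrictMono θ)
    (h : ∀ i, θ (i + q) = θ i + 2 * Real.pi) (t : ℝ) : ∃ j, θ j ≤ t ∧ t < θ (j + 1) := by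
  have hpi := Real.pi_pos
  obtain ⟨k, hk⟩ := exists_int_lt ((t - θ 0) / (2 * Real.pi))
  obtain ⟨l, hl⟩ := exists_int_gt ((t - θ 0) / (2 * Real.pi))
  rw [lt_div_iff₀ (by positivity)] at hk
  rw [div_lt_iff₀ (by positivity)] at hl
  have hk' := add_int_mul_of_add h 0 k
  have hl' := add_int_mul_of_add h 0 l
  obtain ⟨j, hj, hmax⟩ := Int.exists_greatest_of_bdd (P := fun j ↦ θ j ≤ t)
    ⟨0 + q * l, fun z hz ↦ by
      by_contra! hlt
      have := hθ hlt
      linarith⟩ ⟨0 + q * k, by linarith⟩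
  refine ⟨j, hj, ?_⟩
  by_contra! hle
  have := hmax _ hle
  omega

/-- The rays from `O` with directions `θ i` cut the mass `μ` into `q` sectors of equal mass. -/
structure IsEquiFan (μ : Measure Plane) (q : ℕ) (O : Plane) (θ : ℤ → ℝ) : Prop where
  strictMono : StrictMono θ
  add : ∀ i : ℤ, θ (i + (q : ℤ)) = θ i + 2 * Real.pi
  measure : ∀ i : ℤ, μ.real (sweep O (θ i) (θ (i + 1))) = 1 / q

variable {μ : Measure Plane} {q : ℕ} {O : Plane} {θ : ℤ → ℝ}

lemma IsMass.measureReal_sweep_succ (hμ : IsMass μ) (hθ : StrictMono θ)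
    (hadd : ∀ i : ℤ, θ (i + (q : ℤ)) = θ i + 2 * Real.pi) (O : Plane) (i : ℤ) {k : ℕ}
    (hk : k + 1 ≤ q) :
    μ.real (sweep O (θ i) (θ (i + (k + 1 : ℕ)))) =
      μ.real (sweep O (θ i) (θ (i + k))) + μ.real (sweep O (θ (i + k)) (θ (i + k + 1))) := by
  rw [Nat.cast_succ, ← add_assoc]
  refine hμ.measureReal_sweep_add O (hθ.monotone (by omega)) (hθ.monotone (by omega)) ?_
  rw [← hadd]
  exact hθ.monotone (by omega)

lemma measureReal_sweep_self (hμ : IsMass μ) (O : Plane) (a : ℝ) : μ.real (sweep O a a) = 0 := by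
  have := hμ.measureReal_sweep_add O (le_refl a) (le_refl a) (by linarith [Real.pi_pos])
  linarith

lemma IsEquiFan.measureReal_sweep (h : IsEquiFan μ q O θ) (hμ : IsMass μ) (i : ℤ) {k : ℕ}
    (hk : k ≤ q) : μ.real (sweep O (θ i) (θ (i + k))) = k / q := by
  induction k with
  | zero => simp [measureReal_sweep_self hμ]
  | succ k ih =>
    rw [hμ.measureReal_sweep_succ h.strictMono h.add O i hk, ih (by omega), h.measure]
    push_cast; ring

/-- A convex spiral forces every half-plane through its centre to have a large mass. -/
lemma IsEquiFan.le_measureReal_halfPlane (h : IsEquiFan μ q O θ) (hμ : IsMass μ) {p : ℕ}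
    (hp : 0 < p) (hpq : p < q) (hconv : ∀ i : ℤ, θ (i + p) ≤ θ i + Real.pi) (t : ℝ) :
    ((p : ℝ) - 1) / q ≤ μ.real (sweep O t (t + Real.pi)) := by
  have := hμ.1
  -- With `j` the last ray not beyond `t`, convexity puts ray `j + p` before `t + π`; the half-plane
  -- contains the `p - 1` sectors between rays `j + 1` and `j + p`.
  obtain ⟨j, hj, hj'⟩ := exists_index_le_lt h.strictMono h.add t
  have e := h.measureReal_sweep hμ (j + 1) (k := p - 1) (by omega)
  have e' : ((p - 1 : ℕ) : ℝ) = p - 1 := by rw [Nat.cast_sub hp, Nat.cast_one]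
  rw [e'] at e
  rw [← e]
  refine measureReal_mono (sweep_mono O hj'.le ?_)
  rw [show j + 1 + ((p - 1 : ℕ) : ℤ) = j + p by omega]
  linarith [hconv j]

lemma ncard_fin_exists_int {p q : ℕ} (hpq : p < q) (j : ℤ) :
    {i : Fin q | ∃ k : ℤ, (i : ℤ) ≤ j + q * k ∧ j + q * k < i + p}.ncard = p := by
  have hq : (0 : ℤ) < q := by omega
  have hlt : ∀ a : ℤ, (a % q).toNat < q := fun a ↦ by
    have := Int.emod_lt_of_pos a hq
    have := Int.emod_nonneg a hq.ne'
    omega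
  -- The wedges over sector `j` start at `j, j - 1, …, j - p + 1` modulo `q`.
  let f : Fin p → Fin q := fun r ↦ ⟨((j - r) % q).toNat, hlt _⟩
  have hf : ∀ r, ((f r : ℕ) : ℤ) = (j - r) % q := fun r ↦
    Int.toNat_of_nonneg (Int.emod_nonneg _ hq.ne')
  have hinj : Function.Injective f := by
    intro r s hrs
    have h1 : (j - r) % q = (j - s) % q := by rw [← hf r, ← hf s, hrs]
    have h2 := Int.ModEq.dvd h1
    obtain ⟨c, hc⟩ := h2
    have hr := r.2
    have hs := s.2
    have hc0 : c = 0 := by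
      by_contra hne
      rcases lt_or_gt_of_ne hne with h0 | h0
      · nlinarith
      · nlinarith
    rw [hc0] at hc
    ext
    omega
  have : {i : Fin q | ∃ k : ℤ, (i : ℤ) ≤ j + q * k ∧ j + q * k < i + p} = f '' Set.univ := by
    ext i
    simp only [Set.image_univ, Set.mem_range, Set.mem_ofPred_eq]
    constructor
    · rintro ⟨k, h1, h2⟩
      refine ⟨⟨(j + q * k - i).toNat, by omega⟩, ?_⟩
      ext
      have e := hf ⟨(j + q * k - i).toNat, by omega⟩
      have h3 : (j - ((j + q * k - i).toNat : ℤ)) % q = i := by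
        rw [Int.toNat_of_nonneg (by omega), show j - (j + q * k - i) = i + q * (-k) by ring,
          Int.add_mul_emod_self_left, Int.emod_eq_of_lt (by omega) (by omega)]
      rw [← Nat.cast_inj (R := ℤ), e]
      exact h3
    · rintro ⟨r, rfl⟩
      refine ⟨-((j - r) / q), ?_⟩
      rw [hf]
      have := Int.emod_add_mul_ediv (j - r) q
      have hr := r.2
      rw [mul_neg]
      constructor <;> omega
  rw [this, Set.ncard_image_of_injective _ hinj, Set.ncard_univ, Nat.card_eq_fintype_card,
    Fintype.card_fin]

/-- Off the finitely many lines carrying the rays, a point lies strictly inside one sector `j`, and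
membership in a wedge becomes the congruence condition counted by `ncard_fin_exists_int`. -/
lemma IsEquiFan.admits (h : IsEquiFan μ q O θ) (hμ : IsMass μ) {p : ℕ} (hp : 0 < p) (hpq : p < q)
    (hconv : ∀ i : ℤ, θ (i + p) ≤ θ i + Real.pi) : AdmitsSpiralEquicovering μ q p := by
  have := hμ.1
  have hq : (0 : ℤ) < q := by omega
  have hmeas : ∀ i : ℤ, μ.real (sweep O (θ i) (θ (i + p))) = p / q := fun i ↦
    h.measureReal_sweep hμ i hpq.le
  refine ⟨⟨O, θ, h.strictMono, h.add⟩, ⟨?_, ?_⟩, ?_⟩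
  · intro i j
    rw [← measureReal_eq_measureReal_iff]
    exact (hmeas i).trans (hmeas j).symm
  · refine ⟨(fun i : Fin q ↦ lineThrough O (θ ((i : ℕ) : ℤ))) '' Set.univ,
      Set.finite_univ.image _, ?_, ?_⟩
    · rintro L ⟨i, -, rfl⟩
      exact isLine_lineThrough _ _
    · intro x hx
      have hside : ∀ i : Fin q, lineSide O (θ ((i : ℕ) : ℤ)) x ≠ 0 := fun i h0 ↦
        hx _ ⟨i, trivial, rfl⟩ (mem_lineThrough h0)
      have hxO : x ≠ O := by
        rintro rfl
        exact hside ⟨0, by omega⟩ (by simp [lineSide])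
      obtain ⟨r, hr⟩ := exists_isPolar hxO
      set φ := polarAngle O x
      obtain ⟨j, hj, hj'⟩ := exists_index_le_lt h.strictMono h.add φ
      have hne : θ j ≠ φ := by
        intro e
        have h1 := add_int_mul_of_add h.add (j % q) (j / q)
        rw [Int.emod_add_mul_ediv] at h1
        have h2 := Int.emod_nonneg j hq.ne'
        have h3 := Int.emod_lt_of_pos j hq
        refine hside ⟨(j % q).toNat, by omega⟩ ?_
        simp only [Int.toNat_of_nonneg h2]
        refine hr.lineSide_eq_zero (-(j / q)) ?_
        push_cast
        linarith
      refine Eq.trans ?_ (ncard_fin_exists_int hpq j)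
      congr 1
      ext i
      simp only [Set.mem_ofPred_eq, Fan.spiral, Fan.wedge]
      rw [hr.mem_sweep_iff]
      refine exists_congr fun k ↦ and_congr ?_ ?_
      · have e := add_int_mul_of_add h.add (i - q * k) k
        rw [sub_add_cancel] at e
        rw [e, add_le_add_iff_right]
        constructor
        · intro hle
          by_contra! hlt
          have := h.strictMono.monotone (show j + 1 ≤ i - q * k by linarith)
          linarith
        · intro hle
          exact (h.strictMono.monotone (show (i : ℤ) - q * k ≤ j by linarith)).trans hj
      · have e := add_int_mul_of_add h.add (i + p - q * k) k
        rw [sub_add_cancel] at e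
        rw [e, add_le_add_iff_right]
        constructor
        · intro hle
          by_contra! hlt
          have := h.strictMono.monotone (show (i : ℤ) + p - q * k ≤ j by linarith)
          exact hne (le_antisymm hj (hle.trans this))
        · intro hle
          exact hj'.le.trans (h.strictMono.monotone (show j + 1 ≤ (i : ℤ) + p - q * k by linarith))
  · intro i
    exact ⟨convex_sweep O (h.strictMono (by omega)) (hconv i), hmeas i⟩

/-- Equal masses of the wedges at `i` and `i + 1` make the sector masses `p`-periodic. They are also
`q`-periodic, hence constant by Bézout; this is where coprimality enters. -/
lemma AdmitsSpiralEquicovering.exists_isEquiFan {p : ℕ} (hμ : IsMass μ) (hp : 0 < p) (hpq : p < q)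
    (hcop : Nat.Coprime p q) (h : AdmitsSpiralEquicovering μ q p) :
    ∃ O θ, IsEquiFan μ q O θ ∧ ∀ i : ℤ, θ (i + p) ≤ θ i + Real.pi := by
  have := hμ.1
  have hq : (0 : ℤ) < q := by omega
  obtain ⟨⟨O, θ, hθ, hadd⟩, -, hF⟩ := h
  have hper : ∀ (i : ℤ) (k : ℕ),
      sweep O (θ (i % q)) (θ (i % q + k)) = sweep O (θ i) (θ (i + k)) := by
    intro i k
    rw [← sweep_add_int O _ _ (i / q), ← add_int_mul_of_add hadd, ← add_int_mul_of_add hadd,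
      add_right_comm, Int.emod_add_mul_ediv]
  have hW : ∀ i : ℤ, Convex ℝ (sweep O (θ i) (θ (i + p))) ∧
      μ.real (sweep O (θ i) (θ (i + p))) = p / q := by
    intro i
    have h2 := Int.emod_nonneg i hq.ne'
    have h3 := Int.emod_lt_of_pos i hq
    have := hF ⟨(i % q).toNat, by omega⟩
    simp only [Fan.spiral, Fan.wedge, Int.toNat_of_nonneg h2] at this
    rwa [hper] at this
  let M : ℤ → ℝ := fun i ↦ μ.real (sweep O (θ i) (θ (i + 1)))
  have hMq : Function.Periodic M q := by
    intro i
    simp only [M]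
    have h1 := hper (i + q) 1
    have h2 := hper i 1
    rw [Int.add_emod_right, h2] at h1
    exact_mod_cast congrArg μ.real h1.symm
  have hMp : Function.Periodic M p := by
    intro i
    have h1 := hμ.measureReal_sweep_succ hθ hadd O i (k := p) (by omega)
    have h2 := hμ.measureReal_sweep_add O (a := θ i) (b := θ (i + 1)) (c := θ (i + (p + 1 : ℕ)))
      (hθ.monotone (by omega)) (hθ.monotone (by omega))
      (by rw [← hadd]; exact hθ.monotone (by omega))
    rw [show i + ((p + 1 : ℕ) : ℤ) = i + 1 + p by push_cast; ring] at h1 h2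
    rw [(hW i).2] at h1
    rw [(hW (i + 1)).2] at h2
    simp only [M]
    linarith
  have hM1 : Function.Periodic M 1 := by
    have hg : (1 : ℤ) = Nat.gcdA p q * p + Nat.gcdB p q * q := by
      have := Nat.gcd_eq_gcd_ab p q
      rw [hcop] at this
      push_cast at this
      linarith
    rw [hg]
    have h1 := hMp.int_mul (Nat.gcdA p q)
    have h2 := hMq.int_mul (Nat.gcdB p q)
    exact_mod_cast h1.add_period h2
  have hMc : ∀ i, M i = M 0 := fun i ↦ by simpa using hM1.int_mul_eq i
  have hsum : ∀ k : ℕ, k ≤ q → μ.real (sweep O (θ 0) (θ (0 + k))) = k * M 0 := by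
    intro k hk
    induction k with
    | zero => simp [measureReal_sweep_self hμ]
    | succ k ih =>
      rw [hμ.measureReal_sweep_succ hθ hadd O 0 hk, ih (by omega)]
      have := hMc (0 + k)
      simp only [M] at this ⊢
      rw [this]
      push_cast; ring
  have htot := hsum q le_rfl
  rw [hadd, sweep_full, probReal_univ] at htot
  have hq' : (q : ℝ) ≠ 0 := by
    have : (0 : ℝ) < q := by exact_mod_cast hq
    exact this.ne'
  refine ⟨O, θ, ⟨hθ, hadd, fun i ↦ ?_⟩, fun i ↦ ?_⟩
  · change M i = 1 / q
    rw [hMc, eq_div_iff hq']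
    linarith
  · refine le_add_pi_of_convex_sweep ?_ (hW i).1
    rw [← hadd]
    exact hθ (by omega)

/-- The directions `θ i` cut the mass `μ`, swept counter-clockwise around `O` from direction `-π`,
at the levels `(i + s) / q`. -/
structure IsLevelFan (μ : Measure Plane) (q : ℕ) (O : Plane) (s : ℝ) (θ : ℤ → ℝ) : Prop where
  add : ∀ i : ℤ, θ (i + (q : ℤ)) = θ i + 2 * Real.pi
  mem : ∀ i : ℤ, 0 ≤ i → i < q → θ i ∈ Set.Icc (-Real.pi) Real.pi
  mass : ∀ i : ℤ, 0 ≤ i → i < q → angularMass μ O (θ i) = (i + s) / q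

/-- The conditions of a level fan are closed, so they survive limits; the strict order of the rays
is recovered here from the masses. -/
lemma IsLevelFan.isEquiFan {s : ℝ} (h : IsLevelFan μ q O s θ) (hμ : IsMass μ) (hq : 0 < q) :
    IsEquiFan μ q O θ := by
  have := hμ.1
  have hq' : (0 : ℝ) < q := by exact_mod_cast hq
  have hqz : (0 : ℤ) < q := by exact_mod_cast hq
  have hpi := Real.pi_pos
  have hred : ∀ i : ℤ, θ i = θ (i % q) + 2 * Real.pi * (i / q : ℤ) := fun i ↦ by
    rw [← add_int_mul_of_add h.add, Int.emod_add_mul_ediv]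
  have hstep : ∀ r : ℤ, 0 ≤ r → r < q → θ r < θ (r + 1) ∧
      μ.real (sweep O (θ r) (θ (r + 1))) = 1 / q := by
    intro r hr hr'
    rcases lt_or_eq_of_le (show r + 1 ≤ q by omega) with hlt | heq
    · have h1 := h.mass r hr hr'
      have h2 := h.mass (r + 1) (by omega) hlt
      have hθlt : θ r < θ (r + 1) := by
        by_contra! hle
        have := angularMass_mono (μ := μ) O hle
        rw [h1, h2, div_le_div_iff_of_pos_right hq'] at this
        push_cast at this
        linarith
      refine ⟨hθlt, ?_⟩
      rw [hμ.measureReal_sweep O (h.mem r hr hr').1 hθlt.le (h.mem _ (by omega) hlt).2, h1, h2]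
      push_cast; ring
    · have h1 := h.mass r hr hr'
      have h2 := h.mass 0 le_rfl hqz
      have m1 := h.mem r hr hr'
      have m2 := h.mem 0 le_rfl hqz
      have e : θ (r + 1) = θ 0 + 2 * Real.pi := by rw [heq, ← h.add, zero_add]
      have er : (r : ℝ) = q - 1 := by
        have : r = q - 1 := by omega
        rw [this]; push_cast; ring
      -- The sector across the cut degenerates only if `θ r = π` and `θ 0 = -π`, which would force
      -- both `s = 1` and `s = 0`.
      have hθlt : θ r < θ (r + 1) := by
        rw [e]
        by_contra! hle
        have e1 : θ r = Real.pi := by linarith [m1.2, m2.1]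
        have e2 : θ 0 = -Real.pi := by linarith [m1.2, m2.1]
        rw [e1, angularMass_pi, er, eq_div_iff hq'.ne'] at h1
        rw [e2, angularMass_neg_pi, eq_div_iff hq'.ne'] at h2
        push_cast at h2
        linarith
      refine ⟨hθlt, ?_⟩
      have hle : θ 0 ≤ θ r := by
        rcases eq_or_lt_of_le hr with rfl | hr0
        · exact le_rfl
        · by_contra! hlt
          have := angularMass_mono (μ := μ) O hlt.le
          rw [h1, h2, div_le_div_iff_of_pos_right hq'] at this
          have : (0 : ℝ) < r := by exact_mod_cast hr0
          push_cast at *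
          linarith
      have eper : sweep O Real.pi (θ (r + 1)) = sweep O (-Real.pi) (θ 0) := by
        rw [e, ← sweep_add_int O (-Real.pi) (θ 0) 1]
        congr 1 <;> push_cast <;> ring
      rw [hμ.measureReal_sweep_add O m1.2 (by rw [e]; linarith [m2.1]) (by rw [e]; linarith), eper,
        hμ.measureReal_sweep O m1.1 m1.2 le_rfl, hμ.measureReal_sweep_neg_pi O, h1, h2,
        angularMass_pi, er]
      push_cast
      field_simp
      ring
  have hall : ∀ i : ℤ, θ i < θ (i + 1) ∧ μ.real (sweep O (θ i) (θ (i + 1))) = 1 / q := by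
    intro i
    have h1 := hstep (i % q) (Int.emod_nonneg i hqz.ne') (Int.emod_lt_of_pos i hqz)
    have e1 : θ (i + 1) = θ (i % q + 1) + 2 * Real.pi * (i / q : ℤ) := by
      rw [← add_int_mul_of_add h.add, add_right_comm, Int.emod_add_mul_ediv]
    rw [hred i, e1, sweep_add_int]
    exact ⟨by linarith [h1.1], h1.2⟩
  exact ⟨strictMono_int_of_lt_succ fun i ↦ (hall i).1, h.add, fun i ↦ (hall i).2⟩

end SpiralEquicovering

/-! ### Ratios for which convex spirals fail. -/

namespace SpiralEquicovering

/-- `q` convex wedges end to end turn by at most `qπ`, but they make `p` full turns. -/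
lemma not_admits_of_lt_two_mul {μ : Measure Plane} {p q : ℕ} (hμ : IsMass μ) (hp : 0 < p)
    (hpq : p < q) (hcop : Nat.Coprime p q) (hlt : q < 2 * p) :
    ¬ AdmitsSpiralEquicovering μ q p := by
  intro h
  obtain ⟨O, θ, hfan, hconv⟩ := h.exists_isEquiFan hμ hp hpq hcop
  have h1 : ∀ n : ℕ, θ (0 + p * n) ≤ θ 0 + n * Real.pi := by
    intro n
    induction n with
    | zero => simp
    | succ n ih =>
      have := hconv (0 + p * n)
      rw [show (0 : ℤ) + p * n + p = 0 + p * ((n + 1 : ℕ) : ℤ) by push_cast; ring] at this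
      push_cast at this ⊢
      linarith
  have h2 := add_int_mul_of_add hfan.add 0 p
  have h3 := h1 q
  rw [mul_comm, h2] at h3
  have h4 : (q : ℝ) < 2 * p := by exact_mod_cast hlt
  push_cast at h3
  nlinarith [Real.pi_pos]

lemma volume_line {L : AffineSubspace ℝ Plane} (hL : IsLine L) :
    (volume : Measure Plane) (L : Set Plane) = 0 := by
  refine Measure.addHaar_affineSubspace _ L fun htop ↦ ?_
  rw [IsLine, htop, AffineSubspace.direction_top, finrank_top, finrank_euclideanSpace_fin] at hL
  norm_num at hL

/-- A mass for which three half-planes that cover the plane have mass at most `1 / 3` each. -/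
lemma exists_isMass_shallow : ∃ μ : Measure Plane, IsMass μ ∧
    μ {x | 1 / 3 ≤ x 0} ≤ 3⁻¹ ∧ μ {x | 1 / 3 ≤ x 1} ≤ 3⁻¹ ∧ μ {x | x 0 + x 1 ≤ 2 / 3} ≤ 3⁻¹ := by
  let ν : Plane → Measure Plane := fun c ↦ ProbabilityTheory.cond volume (Metric.ball c (1 / 10))
  have hν : ∀ c, IsProbabilityMeasure (ν c) := fun c ↦
    ProbabilityTheory.cond_isProbabilityMeasure_of_finite
      (Metric.isOpen_ball.measure_pos _ ⟨c, by simp⟩).ne' measure_ball_lt_top.ne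
  have hac : ∀ c, ν c ≪ volume := fun c ↦ ProbabilityTheory.cond_absolutelyContinuous
  have hzero : ∀ c (S : Set Plane), (∀ x ∈ Metric.ball c (1 / 10), x ∉ S) → ν c S = 0 := by
    intro c S h
    rw [ProbabilityTheory.cond_apply Metric.isOpen_ball.measurableSet]
    have : Metric.ball c (1 / 10) ∩ S = ∅ := Set.eq_empty_of_forall_notMem fun x hx ↦ h x hx.1 hx.2
    rw [this, measure_empty, mul_zero]
  have hcoord : ∀ c x : Plane, x ∈ Metric.ball c (1 / 10) → ∀ i,
      c i - 1 / 10 < x i ∧ x i < c i + 1 / 10 := by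
    intro c x hx i
    have h1 := PiLp.norm_apply_le (x - c) i
    rw [mem_ball_iff_norm] at hx
    have h2 := abs_lt.1 (h1.trans_lt hx)
    simp only [PiLp.sub_apply] at h2
    constructor <;> linarith [h2.1, h2.2]
  -- Uniform discs of radius `1 / 10` about these points: each of the three half-planes meets only
  -- one of them.
  let a : Plane := !₂[1, 0]
  let b : Plane := !₂[0, 1]
  let c : Plane := !₂[0, 0]
  let μ : Measure Plane := (3⁻¹ : ENNReal) • (ν a + ν b + ν c)
  have hμ : ∀ S, μ S = 3⁻¹ * (ν a S + ν b S + ν c S) := fun S ↦ by simp [μ, mul_add]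
  have hone : ∀ S d, ν d S ≤ 1 := fun S d ↦ prob_le_one
  refine ⟨μ, ⟨⟨?_⟩, ?_⟩, ?_, ?_, ?_⟩
  · rw [hμ]
    simp only [measure_univ]
    rw [show (1 : ENNReal) + 1 + 1 = 3 by norm_num]
    exact ENNReal.inv_mul_cancel (by norm_num) (by norm_num)
  · intro L hL
    have := volume_line hL
    rw [hμ, hac a this, hac b this, hac c this]
    simp
  · rw [hμ, hzero b, hzero c, add_zero, add_zero]
    · exact mul_le_of_le_one_right' (hone _ _)
    · intro x hx
      have := (hcoord _ _ hx 0).2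
      simp [c] at this
      simp only [Set.mem_ofPred_eq]
      norm_num at this ⊢
      linarith
    · intro x hx
      have := (hcoord _ _ hx 0).2
      simp [b] at this
      simp only [Set.mem_ofPred_eq]
      norm_num at this ⊢
      linarith
  · rw [hμ, hzero a, hzero c, add_zero, zero_add]
    · exact mul_le_of_le_one_right' (hone _ _)
    · intro x hx
      have := (hcoord _ _ hx 1).2
      simp [c] at this
      simp only [Set.mem_ofPred_eq]
      norm_num at this ⊢
      linarith
    · intro x hx
      have := (hcoord _ _ hx 1).2
      simp [a] at this
      simp only [Set.mem_ofPred_eq]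
      norm_num at this ⊢
      linarith
  · rw [hμ, hzero a, hzero b, zero_add, zero_add]
    · exact mul_le_of_le_one_right' (hone _ _)
    · intro x hx
      have h0 := (hcoord _ _ hx 0).1
      have h1 := (hcoord _ _ hx 1).1
      simp [b] at h0 h1
      simp only [Set.mem_ofPred_eq, not_le]
      norm_num at h0 h1 ⊢
      linarith
    · intro x hx
      have h0 := (hcoord _ _ hx 0).1
      have h1 := (hcoord _ _ hx 1).1
      simp [a] at h0 h1
      simp only [Set.mem_ofPred_eq, not_le]
      norm_num at h0 h1 ⊢
      linarith

/-- The three shallow half-planes cover the plane. The one containing the centre contains a parallel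
half-plane bounded by a line through the centre, whose mass must be at least `(p - 1) / q > 1 / 3`.
-/
lemma exists_isMass_not_admits {p q : ℕ} (hp : 0 < p) (hpq : p < q) (hcop : Nat.Coprime p q)
    (hlt : (q : ℤ) < 3 * p - 3) : ∃ μ : Measure Plane, IsMass μ ∧
      ¬ AdmitsSpiralEquicovering μ q p := by
  obtain ⟨μ, hμ, h0, h1, h2⟩ := exists_isMass_shallow
  refine ⟨μ, hμ, fun h ↦ ?_⟩
  have := hμ.1
  obtain ⟨O, θ, hfan, hconv⟩ := h.exists_isEquiFan hμ hp hpq hcop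
  have hdepth := hfan.le_measureReal_halfPlane hμ hp hpq hconv
  have hq : (0 : ℝ) < q := by exact_mod_cast hp.trans hpq
  have hbig : (1 : ℝ) / 3 < (p - 1) / q := by
    rw [lt_div_iff₀ hq]
    have : (q : ℝ) < 3 * p - 3 := by exact_mod_cast hlt
    linarith
  have key : ∀ (t : ℝ) (S : Set Plane), μ S ≤ 3⁻¹ → (∀ x, 0 ≤ lineSide O t x → x ∈ S) → False := by
    intro t S hS hsub
    have h3 : μ.real (sweep O t (t + Real.pi)) ≤ 1 / 3 := by
      have : μ (sweep O t (t + Real.pi)) ≤ 3⁻¹ :=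
        (measure_mono fun x hx ↦ hsub x (mem_halfPlane_iff.1 hx)).trans hS
      calc μ.real (sweep O t (t + Real.pi)) ≤ (3⁻¹ : ENNReal).toReal :=
            ENNReal.toReal_mono (by simp) this
        _ = 1 / 3 := by simp
    linarith [hdepth t]
  by_cases c0 : 1 / 3 ≤ O 0
  · refine key (-(Real.pi / 2)) _ h0 fun x hx ↦ ?_
    simp [lineSide] at hx
    simp only [Set.mem_ofPred_eq]
    linarith
  by_cases c1 : 1 / 3 ≤ O 1
  · refine key 0 _ h1 fun x hx ↦ ?_
    simp [lineSide] at hx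
    simp only [Set.mem_ofPred_eq]
    linarith
  · refine key (Real.pi - Real.pi / 4) _ h2 fun x hx ↦ ?_
    rw [lineSide, Real.cos_pi_sub, Real.sin_pi_sub, Real.cos_pi_div_four, Real.sin_pi_div_four] at hx
    have : 0 < √2 / 2 := by positivity
    simp only [Set.mem_ofPred_eq]
    by_contra! hcon
    nlinarith

end SpiralEquicovering

/-! ### Reflex wedges and the balance of their bisectors. -/

namespace SpiralEquicovering

/-- The `p`-wedge that starts at the ray of index `i` spans more than a half-turn. -/
def IsReflex (p : ℕ) (θ : ℤ → ℝ) (i : ℤ) : Prop := θ i + Real.pi < θ (i + p)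

variable {p q : ℕ} {θ : ℤ → ℝ}

lemma isReflex_add_mul (hadd : ∀ i : ℤ, θ (i + (q : ℤ)) = θ i + 2 * Real.pi) (i k : ℤ) :
    IsReflex p θ (i + q * k) ↔ IsReflex p θ i := by
  unfold IsReflex
  rw [add_right_comm, add_int_mul_of_add hadd, add_int_mul_of_add hadd]
  constructor <;> intro <;> linarith

/-- If the interiors of the reflex wedges contain all rays, then three of them, with starting
indices at most `p - 1` apart, cover the plane. -/
lemma reflex_cover (hθ : StrictMono θ) (hadd : ∀ i : ℤ, θ (i + (q : ℤ)) = θ i + 2 * Real.pi)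
    (h2 : 2 * p ≤ q) (hcov : ∀ j, ∃ i, IsReflex p θ i ∧ i < j ∧ j < i + p) :
    (q : ℤ) ≤ 3 * p - 3 ∧ ((q : ℤ) = 3 * p - 3 → ∃ i, IsReflex p θ i ∧
      IsReflex p θ (i + (p - 1 : ℕ)) ∧ IsReflex p θ (i + 2 * (p - 1 : ℕ))) := by
  obtain ⟨i₀, hb₀, -, -⟩ := hcov 0
  -- As `2p ≤ q`, the wedges at `i₀` and `i₀ + p` are consecutive within one turn and cannot both
  -- exceed a half-turn.
  have hnot : ¬ IsReflex p θ (i₀ + p) := by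
    intro h
    unfold IsReflex at h hb₀
    have h3 := hθ.monotone (show i₀ + p + p ≤ i₀ + q by omega)
    rw [hadd] at h3
    linarith
  -- A greedy choice: the reflex wedge over the end of the first one that reaches furthest.
  -- Maximality then places `i₂` beyond the first wedge.
  obtain ⟨i₁, ⟨hb₁, hi₁, hi₁'⟩, hmax⟩ := Int.exists_greatest_of_bdd
    (P := fun i ↦ IsReflex p θ i ∧ i < i₀ + p ∧ i₀ + p < i + p)
    ⟨i₀ + p, fun z hz ↦ hz.2.1.le⟩ (hcov (i₀ + p))
  obtain ⟨i₂, hb₂, hi₂, hi₂'⟩ := hcov (i₁ + p)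
  have hi₂0 : i₀ + p < i₂ := by
    by_contra! hle
    rcases lt_or_eq_of_le hle with hlt | heq
    · have := hmax i₂ ⟨hb₂, hlt, by omega⟩
      omega
    · exact hnot (heq ▸ hb₂)
  have hend : i₀ + q < i₂ + p := by
    by_contra! hle
    have h3 := hθ.monotone hle
    have h4 := hθ hi₂0
    rw [hadd] at h3
    unfold IsReflex at hb₀ hb₂
    linarith
  -- The overlaps give `i₁ ≤ i₀ + p - 1`, `i₂ ≤ i₁ + p - 1` and `i₀ + q ≤ i₂ + p - 1`; equality in
  -- the sum forces equality in each.
  refine ⟨by omega, fun heq ↦ ⟨i₀, hb₀, ?_, ?_⟩⟩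
  · rwa [show i₀ + ((p - 1 : ℕ) : ℤ) = i₁ by omega]
  · rwa [show i₀ + 2 * ((p - 1 : ℕ) : ℤ) = i₂ by omega]

/-- The weighted bisector of the `p`-wedge at index `i`, projected to the direction `φ`; the weight
is zero unless the wedge is reflex. -/
noncomputable def reflexTerm (p : ℕ) (θ : ℤ → ℝ) (φ : ℝ) (i : ℤ) : ℝ :=
  max 0 (-2 * Real.cos ((θ (i + p) - θ i) / 2)) * Real.cos ((θ i + θ (i + p)) / 2 - φ)

/-- The sum of the weighted bisectors of the reflex wedges, projected to the direction `φ`. -/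
noncomputable def reflexSum (p q : ℕ) (θ : ℤ → ℝ) (φ : ℝ) : ℝ :=
  ∑ i ∈ Finset.range q, reflexTerm p θ φ i

/-- The sums are the projections of one plane vector, so two coordinates control all directions. -/
lemma reflexSum_eq (p q : ℕ) (θ : ℤ → ℝ) (φ : ℝ) : reflexSum p q θ φ =
    reflexSum p q θ 0 * Real.cos φ + reflexSum p q θ (Real.pi / 2) * Real.sin φ := by
  unfold reflexSum
  rw [Finset.sum_mul, Finset.sum_mul, ← Finset.sum_add_distrib]
  refine Finset.sum_congr rfl fun i _ ↦ ?_
  unfold reflexTerm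
  rw [Real.cos_sub _ φ, Real.cos_sub_pi_div_two, sub_zero]
  ring

lemma width_lt (hθ : StrictMono θ) (hadd : ∀ i : ℤ, θ (i + (q : ℤ)) = θ i + 2 * Real.pi)
    (hpq : p < q) (i : ℤ) : θ (i + p) < θ i + 2 * Real.pi := by
  rw [← hadd]
  exact hθ (by omega)

lemma IsReflex.cos_neg (hθ : StrictMono θ) (hadd : ∀ i : ℤ, θ (i + (q : ℤ)) = θ i + 2 * Real.pi)
    (hpq : p < q) {i : ℤ} (h : IsReflex p θ i) : Real.cos ((θ (i + p) - θ i) / 2) < 0 := by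
  have := width_lt hθ hadd hpq i
  unfold IsReflex at h
  exact Real.cos_neg_of_pi_div_two_lt_of_lt (by linarith) (by linarith [Real.pi_pos])

/-- The unit vectors of the two bounding rays add up to `2 cos (width / 2)` along the bisector, a
negative multiple for a reflex wedge. -/
lemma IsReflex.reflexTerm_eq (hθ : StrictMono θ)
    (hadd : ∀ i : ℤ, θ (i + (q : ℤ)) = θ i + 2 * Real.pi) (hpq : p < q) {i : ℤ}
    (h : IsReflex p θ i) (φ : ℝ) :
    reflexTerm p θ φ i = -(Real.cos (θ i - φ) + Real.cos (θ (i + p) - φ)) := by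
  have h1 := h.cos_neg hθ hadd hpq
  rw [reflexTerm, max_eq_right (by linarith), Real.cos_add_cos]
  rw [← Real.cos_neg ((θ (i + p) - θ i) / 2)]
  ring_nf

lemma reflexTerm_of_not_isReflex (hθ : StrictMono θ) {i : ℤ} (h : ¬ IsReflex p θ i) (φ : ℝ) :
    reflexTerm p θ φ i = 0 := by
  have h1 := hθ.monotone (show i ≤ i + p by omega)
  unfold IsReflex at h
  have h2 : 0 ≤ Real.cos ((θ (i + p) - θ i) / 2) :=
    Real.cos_nonneg_of_mem_Icc ⟨by linarith [Real.pi_pos], by linarith⟩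
  rw [reflexTerm, max_eq_left (by linarith), zero_mul]

lemma reflexTerm_add_mul (hadd : ∀ i : ℤ, θ (i + (q : ℤ)) = θ i + 2 * Real.pi) (φ : ℝ) (i k : ℤ) :
    reflexTerm p θ φ (i + q * k) = reflexTerm p θ φ i := by
  unfold reflexTerm
  rw [add_right_comm, add_int_mul_of_add hadd, add_int_mul_of_add hadd,
    show θ (i + p) + 2 * Real.pi * k - (θ i + 2 * Real.pi * k) = θ (i + p) - θ i by ring,
    show (θ i + 2 * Real.pi * k + (θ (i + p) + 2 * Real.pi * k)) / 2 - φ =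
      (θ i + θ (i + p)) / 2 - φ + k * (2 * Real.pi) by ring, Real.cos_add_int_mul_two_pi]

lemma exists_int_abs_le_of_cos_nonneg {x : ℝ} (h : 0 ≤ Real.cos x) :
    ∃ k : ℤ, |x - 2 * Real.pi * k| ≤ Real.pi / 2 := by
  have hpi := Real.pi_pos
  obtain ⟨k, hk, _⟩ := existsUnique_add_zsmul_mem_Ico Real.two_pi_pos x (-Real.pi)
  simp only [zsmul_eq_mul] at hk
  refine ⟨-k, ?_⟩
  have e : x - 2 * Real.pi * ((-k : ℤ) : ℝ) = x + k * (2 * Real.pi) := by push_cast; ring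
  rw [e]
  rw [← Real.cos_add_int_mul_two_pi x k, ← Real.cos_abs] at h
  by_contra! hlt
  have h1 : |x + k * (2 * Real.pi)| ≤ Real.pi := abs_le.2 ⟨hk.1, by linarith [hk.2]⟩
  have := Real.cos_neg_of_pi_div_two_lt_of_lt hlt (by linarith)
  linarith

/-- If the reflex bisectors balance, the interiors of the reflex wedges contain all rays. -/
lemma reflex_cover_of_reflexSum_eq_zero (hθ : StrictMono θ)
    (hadd : ∀ i : ℤ, θ (i + (q : ℤ)) = θ i + 2 * Real.pi) (hpq : p < q)
    (hex : ∃ i, IsReflex p θ i) (h0 : reflexSum p q θ 0 = 0)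
    (h1 : reflexSum p q θ (Real.pi / 2) = 0) (j : ℤ) :
    ∃ i, IsReflex p θ i ∧ i < j ∧ j < i + p := by
  have hpi := Real.pi_pos
  have hq : (0 : ℤ) < q := by omega
  have hsum : reflexSum p q θ (θ j) = 0 := by rw [reflexSum_eq, h0, h1]; ring
  -- Vectors with zero sum cannot all have negative projection on the direction of ray `j`.
  have hsome : ∃ i, IsReflex p θ i ∧ 0 ≤ reflexTerm p θ (θ j) i := by
    by_contra! hneg
    obtain ⟨i, hi⟩ := hex
    have hi' : IsReflex p θ (i % q) := by
      rwa [← isReflex_add_mul (q := q) hadd _ (i / q), Int.emod_add_mul_ediv]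
    have : reflexSum p q θ (θ j) < 0 := by
      refine Finset.sum_neg' (fun k _ ↦ ?_) ⟨(i % q).toNat, ?_, ?_⟩
      · by_cases hk : IsReflex p θ k
        · exact (hneg k hk).le
        · exact (reflexTerm_of_not_isReflex hθ hk _).le
      · have := Int.emod_lt_of_pos i hq
        rw [Finset.mem_range]; omega
      · rw [Int.toNat_of_nonneg (Int.emod_nonneg i hq.ne')]
        exact hneg _ hi'
    linarith
  obtain ⟨i, hi, hterm⟩ := hsome
  have hcos := hi.cos_neg hθ hadd hpq
  rw [reflexTerm, max_eq_right (by linarith), mul_nonneg_iff_of_pos_left (by linarith)] at hterm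
  -- Ray `j` is within a quarter-turn of the bisector, and a reflex wedge extends further than that
  -- to both sides.
  obtain ⟨k, hk⟩ := exists_int_abs_le_of_cos_nonneg hterm
  rw [abs_le] at hk
  have e := add_int_mul_of_add hadd j k
  refine ⟨i + q * (-k), (isReflex_add_mul hadd _ _).2 hi, ?_, ?_⟩
  · have : i < j + q * k := by
      by_contra! hle
      have := hθ.monotone hle
      unfold IsReflex at hi
      linarith [hk.1, hk.2]
    linarith
  · have : j + q * k < i + p := by
      by_contra! hle
      have := hθ.monotone hle
      unfold IsReflex at hi
      linarith [hk.1, hk.2]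
    linarith

/-- All rays but the one at `j + 1` point almost opposite to `ω`. A wedge has at most one end there,
so its term is at least `-1 / q`; the wedge at `j` has no end there and contributes at least `2 (1 -
1 / q)`. The total is at least `1 - 1 / q`. -/
lemma reflexSum_pos {ω : ℝ} {j : ℤ} (hθ : StrictMono θ)
    (hadd : ∀ i : ℤ, θ (i + (q : ℤ)) = θ i + 2 * Real.pi) (hp : 2 ≤ p) (hpq : p < q)
    (hj : IsReflex p θ j)
    (hcone : ∀ i : ℤ, ¬ (q : ℤ) ∣ i - (j + 1) → Real.cos (θ i - ω) ≤ -(1 - 1 / (q : ℝ))) :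
    0 < reflexSum p q θ ω := by
  have hq : (0 : ℤ) < q := by omega
  have hq' : (0 : ℝ) < q := by exact_mod_cast hq
  have hq1 : (1 : ℝ) < q := by exact_mod_cast (by omega : 1 < q)
  have hsmall : ∀ a : ℤ, 0 < a → a < q → ¬ (q : ℤ) ∣ a := fun a h1 h2 hd ↦
    absurd (Int.le_of_dvd h1 hd) (by omega)
  have hterm : ∀ i : ℤ, -(1 / (q : ℝ)) ≤ reflexTerm p θ ω i := by
    intro i
    by_cases hi : IsReflex p θ i
    · rw [hi.reflexTerm_eq hθ hadd hpq]
      have b1 := Real.cos_le_one (θ i - ω)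
      have b2 := Real.cos_le_one (θ (i + p) - ω)
      by_cases hd : (q : ℤ) ∣ i - (j + 1)
      · have : ¬ (q : ℤ) ∣ i + p - (j + 1) := by
          intro hd'
          have := dvd_sub hd' hd
          rw [show i + p - (j + 1) - (i - (j + 1)) = (p : ℤ) by ring] at this
          exact hsmall p (by omega) (by omega) this
        linarith [hcone _ this]
      · linarith [hcone _ hd]
    · rw [reflexTerm_of_not_isReflex hθ hi]
      exact neg_nonpos.2 (by positivity)
  have hbig : 2 * (1 - 1 / (q : ℝ)) ≤ reflexTerm p θ ω (j % q) := by
    rw [← reflexTerm_add_mul hadd ω (j % q) (j / q), Int.emod_add_mul_ediv,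
      hj.reflexTerm_eq hθ hadd hpq]
    have h1 := hcone j (by
      rw [show j - (j + 1) = -1 by ring, dvd_neg]
      exact hsmall 1 (by omega) (by omega))
    have h2 := hcone (j + p) (by
      rw [show j + p - (j + 1) = (p : ℤ) - 1 by ring]
      exact hsmall _ (by omega) (by omega))
    linarith
  have hmem : (j % q).toNat ∈ Finset.range q := by
    have := Int.emod_lt_of_pos j hq
    rw [Finset.mem_range]; omega
  rw [reflexSum, ← Finset.add_sum_erase _ _ hmem, Int.toNat_of_nonneg (Int.emod_nonneg j hq.ne')]
  have hrest := Finset.card_nsmul_le_sum ((Finset.range q).erase (j % q).toNat)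
    (fun i : ℕ ↦ reflexTerm p θ ω i) (-(1 / (q : ℝ))) fun i _ ↦ hterm i
  rw [Finset.card_erase_of_mem hmem, Finset.card_range, nsmul_eq_mul, Nat.cast_sub (by omega),
    Nat.cast_one] at hrest
  have e : 2 * (1 - 1 / (q : ℝ)) + (q - 1) * -(1 / (q : ℝ)) = 1 - 1 / q := by
    field_simp; ring
  have : 1 / (q : ℝ) < 1 := by rw [div_lt_one hq']; exact hq1
  linarith

lemma IsPolar.norm_eq {O : Plane} {R ω : ℝ} (hO : IsPolar 0 O R ω) : ‖O‖ = R := by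
  obtain ⟨hR0, hO0, hO1⟩ := hO
  simp only [PiLp.zero_apply, sub_zero] at hO0 hO1
  have h2 := EuclideanSpace.real_norm_sq_eq O
  rw [Fin.sum_univ_two, hO0, hO1] at h2
  have h3 : ‖O‖ ^ 2 = R ^ 2 := by
    rw [h2]; linear_combination R ^ 2 * Real.cos_sq_add_sin_sq ω
  rcases sq_eq_sq_iff_eq_or_eq_neg.1 h3 with h | h
  · exact h
  · linarith [norm_nonneg O]

lemma coord_le_norm (x : Plane) (t : ℝ) : x 0 * Real.cos t + x 1 * Real.sin t ≤ ‖x‖ := by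
  refine (abs_le_of_sq_le_sq' ?_ (norm_nonneg x)).2
  have h := EuclideanSpace.real_norm_sq_eq x
  rw [Fin.sum_univ_two] at h
  have hc := Real.cos_sq_add_sin_sq t
  have e : x 0 ^ 2 + x 1 ^ 2 - (x 0 * Real.cos t + x 1 * Real.sin t) ^ 2 =
      (x 0 * Real.sin t - x 1 * Real.cos t) ^ 2 := by
    linear_combination (-x 0 ^ 2 - x 1 ^ 2) * hc
  have := sq_nonneg (x 0 * Real.sin t - x 1 * Real.cos t)
  linarith

/-- The component of `x - O` along `ω` is at most `r - R`, and its length is at most `r + R`. -/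
lemma IsPolar.cos_le_of_norm_lt {O x : Plane} {r R ω ρ φ κ : ℝ} (hO : IsPolar 0 O R ω)
    (hκ : 0 ≤ κ) (hkey : κ * (r + R) ≤ R - r) (hx : ‖x‖ < r) (hxp : IsPolar O x ρ φ) :
    Real.cos (φ - ω) ≤ -κ := by
  obtain ⟨hR0, hO0, hO1⟩ := hO
  simp only [PiLp.zero_apply, sub_zero] at hO0 hO1
  obtain ⟨hρ, h0, h1⟩ := hxp
  have hc1 := Real.cos_sq_add_sin_sq ω
  have hc2 := Real.cos_sq_add_sin_sq φ
  have hproj : ρ * Real.cos (φ - ω) = x 0 * Real.cos ω + x 1 * Real.sin ω - R := by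
    rw [Real.cos_sub]
    linear_combination (-Real.cos ω) * h0 - Real.sin ω * h1 - Real.cos ω * hO0
      - Real.sin ω * hO1 - R * hc1
  have hxr := coord_le_norm x ω
  have hρle : ρ ≤ r + R := by
    have e : x 0 * Real.cos φ + x 1 * Real.sin φ = ρ + R * Real.cos (φ - ω) := by
      rw [Real.cos_sub]
      linear_combination Real.cos φ * h0 + Real.sin φ * h1 + Real.cos φ * hO0
        + Real.sin φ * hO1 + ρ * hc2
    have h2 := coord_le_norm x φ
    have h3 := mul_le_mul_of_nonneg_left (Real.neg_one_le_cos (φ - ω)) hR0.le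
    linarith
  have h4 : κ * ρ ≤ κ * (r + R) := mul_le_mul_of_nonneg_left hρle hκ
  by_contra! hlt
  have := mul_lt_mul_of_pos_left hlt hρ
  linarith

/-- Seen from a point that is far away, the reflex bisectors point away from the mass. -/
lemma IsEquiFan.reflexSum_pos {μ : Measure Plane} {O : Plane} {r R ω : ℝ} (hμ : IsMass μ)
    (h : IsEquiFan μ q O θ) (hp : 2 ≤ p) (hpq : p < q) (hr : 0 < r)
    (hfar : μ.real {x | r ≤ ‖x‖} < 1 / q) (hO : IsPolar 0 O R ω) (hR : 2 * q * r ≤ R) :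
    0 < reflexSum p q θ ω := by
  have := hμ.1
  have hpi := Real.pi_pos
  have hq' : (0 : ℝ) < q := by exact_mod_cast (by omega : 0 < q)
  have hq1 : (2 : ℝ) < q := by exact_mod_cast (by omega : 2 < q)
  set κ : ℝ := 1 - 1 / q with hκ
  have hκq : κ * q = q - 1 := by rw [hκ]; field_simp
  have hκ0 : 0 < κ := by nlinarith
  have hκ1 : κ < 1 := by nlinarith
  have hRr : r < R := by nlinarith
  have hkey : κ * (r + R) ≤ R - r := by
    have h1 : R / q = (1 - κ) * R := by rw [hκ]; ring
    have h2 : 2 * r ≤ R / q := by rw [le_div_iff₀ hq']; linarith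
    have h3 : κ * r ≤ r := mul_le_of_le_one_left hr.le hκ1.le
    linarith
  -- No point of the ball of radius `r` is seen from `O` inside the arc `(ω - δ, ω + δ)`, which is
  -- wider than a half-turn.
  set δ := Real.arccos (-κ) with hδ
  have hcosδ : Real.cos δ = -κ := Real.cos_arccos (by linarith) (by linarith)
  have hδ2 : Real.pi / 2 < δ := by
    by_contra! hle
    have := Real.cos_nonneg_of_mem_Icc (x := δ) ⟨by linarith [Real.arccos_nonneg (-κ)], hle⟩
    linarith
  have hδpi : δ ≤ Real.pi := Real.arccos_le_pi _
  have hgap : ∀ a, |a - ω| < δ → -κ < Real.cos (a - ω) := by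
    intro a ha
    rw [← hcosδ, ← Real.cos_abs (a - ω)]
    exact Real.cos_lt_cos_of_nonneg_of_le_pi (abs_nonneg _) hδpi ha
  -- A whole sector inside the arc would miss the ball and have mass below `1 / q`. Hence the arc
  -- contains at most one ray, and for `p ≥ 2` the wedge starting just before it is reflex.
  have htwo : ∀ i, ω - δ < θ i → ω + δ ≤ θ (i + 1) := by
    intro i hi
    by_contra! hlt
    have hsub : sweep O (θ i) (θ (i + 1)) ⊆ {x | r ≤ ‖x‖} := by
      intro x hx
      simp only [Set.mem_ofPred_eq]
      by_contra! hxr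
      have hxO : x ≠ O := by
        rintro rfl
        rw [hO.norm_eq] at hxr
        linarith
      obtain ⟨ρ, hρ⟩ := exists_isPolar hxO
      obtain ⟨k, hk1, hk2⟩ := hρ.mem_sweep_iff.1 hx
      have h5 := hO.cos_le_of_norm_lt hκ0.le hkey hxr hρ
      have h6 := hgap (polarAngle O x + 2 * Real.pi * k) (abs_lt.2 ⟨by linarith, by linarith⟩)
      rw [show polarAngle O x + 2 * Real.pi * k - ω = polarAngle O x - ω + k * (2 * Real.pi) by ring,
        Real.cos_add_int_mul_two_pi] at h6
      linarith
    have := measureReal_mono (μ := μ) hsub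
    rw [h.measure] at this
    linarith
  obtain ⟨j, hj, hj'⟩ := exists_index_le_lt h.strictMono h.add (ω - δ)
  have hj2 := htwo (j + 1) hj'
  refine SpiralEquicovering.reflexSum_pos (j := j) h.strictMono h.add hp hpq ?_ ?_
  · have := h.strictMono.monotone (show j + 1 + 1 ≤ j + p by omega)
    unfold IsReflex
    linarith
  · intro i hi
    by_contra! hlt
    obtain ⟨k, hk, _⟩ := existsUnique_add_zsmul_mem_Ico Real.two_pi_pos (θ i - ω) (-Real.pi)
    simp only [zsmul_eq_mul] at hk
    have e := add_int_mul_of_add h.add i k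
    have hk' : |θ (i + q * k) - ω| ≤ Real.pi := by
      rw [e]; exact abs_le.2 ⟨by linarith [hk.1], by linarith [hk.2]⟩
    have hin : |θ (i + q * k) - ω| < δ := by
      by_contra! hle
      have := Real.cos_le_cos_of_nonneg_of_le_pi (by linarith) hk' hle
      rw [Real.cos_abs, hcosδ, e,
        show θ i + 2 * Real.pi * k - ω = θ i - ω + k * (2 * Real.pi) by ring,
        Real.cos_add_int_mul_two_pi] at this
      linarith
    rw [abs_lt] at hin
    have h1 : j < i + q * k := by
      by_contra! hle
      have := h.strictMono.monotone hle
      linarith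
    have h2 : i + q * k < j + 1 + 1 := by
      by_contra! hle
      have := h.strictMono.monotone hle
      linarith
    exact hi ⟨-k, by linarith [show i + q * k = j + 1 by omega]⟩

end SpiralEquicovering

/-! ### Continuous families of equal fans. -/

namespace SpiralEquicovering

/-- The direction at which the angular mass around `O` reaches the level `y`, clamped to
`[0, 1]`. -/
noncomputable def levelAngle (μ : Measure Plane) (O : Plane) (y : ℝ) : ℝ :=
  Classical.epsilon fun t ↦ t ∈ Set.Icc (-Real.pi) Real.pi ∧ angularMass μ O t = max 0 (min 1 y)

variable {μ : Measure Plane} {q : ℕ}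

lemma IsMass.levelAngle_spec (hμ : IsMass μ) (O : Plane) (y : ℝ) :
    levelAngle μ O y ∈ Set.Icc (-Real.pi) Real.pi ∧
      angularMass μ O (levelAngle μ O y) = max 0 (min 1 y) := by
  have := hμ.1
  have hpi := Real.pi_pos
  refine Classical.epsilon_spec (p := fun t ↦ t ∈ Set.Icc (-Real.pi) Real.pi ∧
    angularMass μ O t = max 0 (min 1 y)) ?_
  have hc : ContinuousOn (angularMass μ O) (Set.Icc (-Real.pi) Real.pi) :=
    (hμ.continuous_angularMass.comp (Continuous.prodMk_right O)).continuousOn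
  have hivt := intermediate_value_Icc (by linarith) hc
  rw [angularMass_neg_pi, angularMass_pi] at hivt
  obtain ⟨t, ht, e⟩ := hivt
    (show max 0 (min 1 y) ∈ Set.Icc (0 : ℝ) 1 from ⟨le_max_left _ _, by simp⟩)
  exact ⟨t, ht, e⟩

lemma IsMass.levelAngle_eq [μ.IsOpenPosMeasure] (hμ : IsMass μ) {O : Plane} {y t : ℝ}
    (ht : t ∈ Set.Icc (-Real.pi) Real.pi) (h : angularMass μ O t = max 0 (min 1 y)) :
    levelAngle μ O y = t := by
  have := hμ.1
  obtain ⟨h1, h2⟩ := hμ.levelAngle_spec O y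
  exact (angularMass_strictMonoOn O).injOn h1 ht (h2.trans h.symm)

/-- Strict monotonicity of the angular mass, hence positivity on open sets, turns a strict bound on
the level angle into a strict inequality of masses, stable in `(O, y)`. -/
lemma IsMass.continuous_levelAngle [μ.IsOpenPosMeasure] (hμ : IsMass μ) :
    Continuous fun a : Plane × ℝ ↦ levelAngle μ a.1 a.2 := by
  have := hμ.1
  rw [continuous_iff_continuousAt]
  rintro ⟨O, y⟩
  obtain ⟨hm, he⟩ := hμ.levelAngle_spec O y
  have hG : ∀ t, ContinuousAt (fun a : Plane × ℝ ↦ angularMass μ a.1 t) (O, y) := fun t ↦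
    (hμ.continuous_angularMass.comp (by fun_prop : Continuous fun a : Plane × ℝ ↦
      (a.1, t))).continuousAt
  have hY : ContinuousAt (fun a : Plane × ℝ ↦ max 0 (min 1 a.2)) (O, y) := by fun_prop
  refine tendsto_order.2 ⟨fun t ht ↦ ?_, fun t ht ↦ ?_⟩
  · change t < levelAngle μ O y at ht
    rcases lt_or_ge t (-Real.pi) with hlt | hge
    · exact Eventually.of_forall fun a ↦ hlt.trans_le (hμ.levelAngle_spec a.1 a.2).1.1
    · have h1 : angularMass μ O t < max 0 (min 1 y) := by
        rw [← he]
        exact angularMass_strictMonoOn O ⟨hge, ht.le.trans hm.2⟩ hm ht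
      filter_upwards [(hG t).eventually_lt hY h1] with a ha
      by_contra! hle
      have := angularMass_mono (μ := μ) a.1 hle
      rw [(hμ.levelAngle_spec a.1 a.2).2] at this
      linarith
  · change levelAngle μ O y < t at ht
    rcases lt_or_ge Real.pi t with hlt | hge
    · exact Eventually.of_forall fun a ↦ (hμ.levelAngle_spec a.1 a.2).1.2.trans_lt hlt
    · have h1 : max 0 (min 1 y) < angularMass μ O t := by
        rw [← he]
        exact angularMass_strictMonoOn O hm ⟨hm.1.trans ht.le, hge⟩ ht
      filter_upwards [hY.eventually_lt (hG t) h1] with a ha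
      by_contra! hle
      have := angularMass_mono (μ := μ) a.1 hle
      rw [(hμ.levelAngle_spec a.1 a.2).2] at this
      linarith

/-- The lifted directions of the rays from `O` that cut the mass at the levels `(i + s) / q`. -/
noncomputable def levelFan (μ : Measure Plane) (q : ℕ) (O : Plane) (s : ℝ) (i : ℤ) : ℝ :=
  levelAngle μ O (((i % q : ℤ) + s) / q) + 2 * Real.pi * (i / q : ℤ)

lemma IsMass.isLevelFan (hμ : IsMass μ) (hq : 0 < q) (O : Plane) {s : ℝ}
    (hs : s ∈ Set.Icc (0 : ℝ) 1) : IsLevelFan μ q O s (levelFan μ q O s) := by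
  have hqz : (0 : ℤ) < q := by exact_mod_cast hq
  have hq' : (0 : ℝ) < q := by exact_mod_cast hq
  have hval : ∀ i : ℤ, 0 ≤ i → i < q → levelFan μ q O s i = levelAngle μ O ((i + s) / q) := by
    intro i h1 h2
    rw [levelFan, Int.emod_eq_of_lt h1 h2, Int.ediv_eq_zero_of_lt h1 h2]
    simp
  refine ⟨fun i ↦ ?_, fun i h1 h2 ↦ ?_, fun i h1 h2 ↦ ?_⟩
  · rw [levelFan, levelFan, Int.add_emod_right, Int.add_ediv_of_dvd_right dvd_rfl,
      Int.ediv_self hqz.ne']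
    push_cast; ring
  · rw [hval i h1 h2]
    exact (hμ.levelAngle_spec _ _).1
  · rw [hval i h1 h2, (hμ.levelAngle_spec _ _).2]
    have h3 : (0 : ℝ) ≤ i := by exact_mod_cast h1
    have h4 : (i : ℝ) + 1 ≤ q := by exact_mod_cast h2
    rw [min_eq_right, max_eq_right]
    · have := hs.1; positivity
    · rw [div_le_one hq']; linarith [hs.2]

/-- Raising all levels by `1 / q` advances the index by one. At the cut, level `1` at `π` becomes
level `0` at `-π`, one turn later; uniqueness of the level angles is needed there. -/
lemma IsMass.levelFan_one [μ.IsOpenPosMeasure] (hμ : IsMass μ) (hq : 0 < q) (O : Plane) (i : ℤ) :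
    levelFan μ q O 1 i = levelFan μ q O 0 (i + 1) := by
  have := hμ.1
  have hpi := Real.pi_pos
  have hqz : (0 : ℤ) < q := by exact_mod_cast hq
  have hq' : (0 : ℝ) < q := by exact_mod_cast hq
  have e := Int.emod_add_mul_ediv i q
  have h1 := Int.emod_nonneg i hqz.ne'
  have h2 := Int.emod_lt_of_pos i hqz
  unfold levelFan
  rcases lt_or_eq_of_le (show i % q + 1 ≤ q by omega) with hlt | heq
  · have e1 : i + 1 = (i % q + 1) + q * (i / q) := by linarith
    have e2 : (i + 1) % q = i % q + 1 := by
      rw [e1, Int.add_mul_emod_self_left, Int.emod_eq_of_lt (by omega) hlt]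
    have e3 : (i + 1) / q = i / q := by
      rw [e1, Int.add_mul_ediv_left _ _ hqz.ne', Int.ediv_eq_zero_of_lt (by omega) hlt, zero_add]
    rw [e2, e3]
    push_cast
    rw [add_zero]
  · have e1 : i + 1 = 0 + q * (i / q + 1) := by linarith
    have e2 : (i + 1) % q = 0 := by rw [e1, Int.add_mul_emod_self_left, Int.zero_emod]
    have e3 : (i + 1) / q = i / q + 1 := by
      rw [e1, Int.add_mul_ediv_left _ _ hqz.ne', Int.zero_ediv, zero_add]
    have e4 : ((i % q : ℤ) + 1 : ℝ) = q := by exact_mod_cast heq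
    rw [e2, e3, e4, div_self hq'.ne', hμ.levelAngle_eq (t := Real.pi) ⟨by linarith, le_rfl⟩
      (by rw [angularMass_pi]; simp), hμ.levelAngle_eq (t := -Real.pi) ⟨le_rfl, by linarith⟩
      (by rw [angularMass_neg_pi]; simp)]
    push_cast; ring

lemma IsMass.continuous_levelFan [μ.IsOpenPosMeasure] (hμ : IsMass μ) (i : ℤ) :
    Continuous fun a : ℝ × ℝ × ℝ ↦ levelFan μ q !₂[a.1, a.2.1] a.2.2 i := by
  unfold levelFan
  have h1 : Continuous fun a : ℝ × ℝ × ℝ ↦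
      ((!₂[a.1, a.2.1] : Plane), ((i % q : ℤ) + a.2.2) / (q : ℝ)) := by
    refine Continuous.prodMk ?_ (by fun_prop)
    refine (PiLp.continuous_toLp 2 _).comp (continuous_pi fun k ↦ ?_)
    fin_cases k <;> simp <;> fun_prop
  exact (hμ.continuous_levelAngle.comp h1).add continuous_const

lemma exists_real_far_lt [IsFiniteMeasure μ] {ε : ℝ} (hε : 0 < ε) :
    ∃ r, 0 < r ∧ μ.real {x | r ≤ ‖x‖} < ε := by
  have hanti : Antitone fun n : ℕ ↦ {x : Plane | (n : ℝ) ≤ ‖x‖} := by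
    intro m n hmn x hx
    have hx' : (n : ℝ) ≤ ‖x‖ := hx
    exact le_trans (by exact_mod_cast hmn) hx'
  have hlim := tendsto_measure_iInter_atTop (μ := μ) (s := fun n : ℕ ↦ {x : Plane | (n : ℝ) ≤ ‖x‖})
    (fun n ↦ (measurableSet_le measurable_const measurable_norm).nullMeasurableSet) hanti
    ⟨0, measure_ne_top _ _⟩
  have hempty : ⋂ n : ℕ, {x : Plane | (n : ℝ) ≤ ‖x‖} = ∅ := by
    refine Set.eq_empty_of_forall_notMem fun x hx ↦ ?_
    obtain ⟨n, hn⟩ := exists_nat_gt ‖x‖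
    have := Set.mem_iInter.1 hx n
    simp only [Set.mem_ofPred_eq] at this
    linarith
  rw [hempty, measure_empty] at hlim
  have hlim' := (ENNReal.tendsto_toReal ENNReal.zero_ne_top).comp hlim
  obtain ⟨n, hn, hn'⟩ := ((hlim'.eventually (gt_mem_nhds (by simpa using hε))).and
    (eventually_gt_atTop 0)).exists
  exact ⟨n, by exact_mod_cast hn', hn⟩

end SpiralEquicovering

/-! ### Equally spaced triples of reflex wedges; existence for masses of full support. -/

namespace SpiralEquicovering

/-- The excess over a half-turn of the `p`-wedge at index `i`. -/
noncomputable def reflexExcess (p : ℕ) (θ : ℤ → ℝ) (i : ℤ) : ℝ := θ (i + p) - θ i - Real.pi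

lemma isReflex_iff {p : ℕ} {θ : ℤ → ℝ} {i : ℤ} : IsReflex p θ i ↔ 0 < reflexExcess p θ i := by
  unfold IsReflex reflexExcess
  constructor <;> intro <;> linarith

/-- The least excess of the three `p`-wedges at the indices `i`, `i + g`, `i + 2 g`, clamped below
by `0`. -/
noncomputable def tripleExcess (p g : ℕ) (θ : ℤ → ℝ) (i : ℤ) : ℝ :=
  max 0 (min (reflexExcess p θ i) (min (reflexExcess p θ (i + g)) (reflexExcess p θ (i + 2 * g))))

lemma tripleExcess_pos_iff {p g : ℕ} {θ : ℤ → ℝ} {i : ℤ} : 0 < tripleExcess p g θ i ↔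
    IsReflex p θ i ∧ IsReflex p θ (i + g) ∧ IsReflex p θ (i + 2 * g) := by
  simp [tripleExcess, isReflex_iff]

lemma tripleExcess_periodic {p g : ℕ} {θ : ℤ → ℝ}
    (hadd : ∀ i : ℤ, θ (i + ((3 * g : ℕ) : ℤ)) = θ i + 2 * Real.pi) :
    Function.Periodic (tripleExcess p g θ) g := by
  intro i
  have e : reflexExcess p θ (i + g + 2 * g) = reflexExcess p θ i := by
    have h1 := hadd i
    have h2 := hadd (i + p)
    push_cast at h1 h2
    unfold reflexExcess
    rw [show i + g + 2 * g + (p : ℤ) = i + p + 3 * g by ring,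
      show i + g + 2 * g = i + 3 * (g : ℤ) by ring, h1, h2]
    ring
  unfold tripleExcess
  rw [e, show i + (g : ℤ) + g = i + 2 * g by ring, min_comm (reflexExcess p θ i), ← min_assoc]

/-- At most one triple of equally spaced wedges can consist of reflex wedges. -/
lemma tripleExcess_unique {p g : ℕ} {θ : ℤ → ℝ} (hp : p = g + 1) (hθ : StrictMono θ)
    (hadd : ∀ i : ℤ, θ (i + ((3 * g : ℕ) : ℤ)) = θ i + 2 * Real.pi) {i j : ℤ} (hi : 0 ≤ i)
    (hij : i < j) (hj : j < g) (h1 : 0 < tripleExcess p g θ i) : tripleExcess p g θ j = 0 := by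
  by_contra hne
  have h2 : 0 < tripleExcess p g θ j := lt_of_le_of_ne (le_max_left _ _) (Ne.symm hne)
  -- Let `Σ(i)` be the sum of `θ` at `i`, `i + g`, `i + 2g`. A reflex triple makes it jump by more
  -- than `π` from `i` to `i + 1`, whereas it grows by only `2π` from `0` to `g`.
  have key : ∀ i, 0 < tripleExcess p g θ i →
      θ i + θ (i + g) + θ (i + 2 * g) + Real.pi <
        θ (i + 1) + θ (i + 1 + g) + θ (i + 1 + 2 * g) := by
    intro i h
    obtain ⟨a, b, c⟩ := tripleExcess_pos_iff.1 h
    have h3 := hadd (i + 1)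
    unfold IsReflex at a b c
    push_cast at h3
    rw [hp] at a b c
    push_cast at a b c
    rw [show i + ((g : ℤ) + 1) = i + 1 + g by ring] at a
    rw [show i + (g : ℤ) + (g + 1) = i + 1 + 2 * g by ring] at b
    rw [show i + 2 * (g : ℤ) + (g + 1) = i + 1 + 3 * g by ring, h3] at c
    linarith
  have k1 := key i h1
  have k2 := key j h2
  have h3 := hadd 0
  push_cast at h3
  have m0 := hθ.monotone (show 0 ≤ i by omega)
  have m1 := hθ.monotone (show 0 + (g : ℤ) ≤ i + g by omega)
  have m2 := hθ.monotone (show 0 + 2 * (g : ℤ) ≤ i + 2 * g by omega)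
  have n0 := hθ.monotone (show i + 1 ≤ j by omega)
  have n1 := hθ.monotone (show i + 1 + (g : ℤ) ≤ j + g by omega)
  have n2 := hθ.monotone (show i + 1 + 2 * (g : ℤ) ≤ j + 2 * g by omega)
  have l0 := hθ.monotone (show j + 1 ≤ 0 + (g : ℤ) by omega)
  have l1 := hθ.monotone (show j + 1 + (g : ℤ) ≤ 0 + 2 * g by omega)
  have l2 := hθ.monotone (show j + 1 + 2 * (g : ℤ) ≤ 0 + 3 * g by omega)
  linarith

/-- The alternating sum of the triple excesses. -/
noncomputable def alternatingExcess (p g : ℕ) (θ : ℤ → ℝ) : ℝ :=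
  ∑ i ∈ Finset.range g, (-1 : ℝ) ^ i * tripleExcess p g θ i

/-- The term that wraps round from index `g` to `0` keeps its sign because `g` is even. -/
lemma sum_alternating_shift {g : ℕ} (hg : Even g) {T : ℤ → ℝ} (hT : Function.Periodic T g) :
    ∑ i ∈ Finset.range g, (-1 : ℝ) ^ i * T (i + 1) =
      -∑ i ∈ Finset.range g, (-1 : ℝ) ^ i * T i := by
  have h1 := Finset.sum_range_succ (fun i : ℕ ↦ (-1 : ℝ) ^ i * T i) g
  have h2 := Finset.sum_range_succ' (fun i : ℕ ↦ (-1 : ℝ) ^ i * T i) g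
  have h3 := hT 0
  rw [zero_add] at h3
  rw [hg.neg_one_pow, h3] at h1
  have h4 : ∑ i ∈ Finset.range g, (-1 : ℝ) ^ (i + 1) * T ((i + 1 : ℕ) : ℤ) =
      -∑ i ∈ Finset.range g, (-1 : ℝ) ^ i * T (i + 1) := by
    rw [← Finset.sum_neg_distrib]
    refine Finset.sum_congr rfl fun i _ ↦ ?_
    push_cast; ring
  rw [h4] at h2
  simp at h1 h2
  linarith

lemma alternatingExcess_ne_zero {p g : ℕ} {θ : ℤ → ℝ} (hp : p = g + 1) (hg : 0 < g)
    (hθ : StrictMono θ) (hadd : ∀ i : ℤ, θ (i + ((3 * g : ℕ) : ℤ)) = θ i + 2 * Real.pi)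
    (hex : ∃ i, IsReflex p θ i ∧ IsReflex p θ (i + g) ∧ IsReflex p θ (i + 2 * g)) :
    alternatingExcess p g θ ≠ 0 := by
  obtain ⟨i, hi⟩ := hex
  have hgz : (0 : ℤ) < g := by exact_mod_cast hg
  have hpos := tripleExcess_pos_iff.2 hi
  have hper := (tripleExcess_periodic (p := p) hadd).int_mul (i / g) (i % g)
  rw [Int.cast_id, mul_comm, Int.emod_add_mul_ediv] at hper
  rw [hper] at hpos
  have h1 := Int.emod_nonneg i hgz.ne'
  have h2 := Int.emod_lt_of_pos i hgz
  obtain ⟨r, hr⟩ := Int.eq_ofNat_of_zero_le h1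
  rw [hr] at hpos h2
  have hrg : r < g := by exact_mod_cast h2
  rw [alternatingExcess, Finset.sum_eq_single r]
  · exact mul_ne_zero (pow_ne_zero _ (by norm_num)) hpos.ne'
  · intro k hk hne
    rw [Finset.mem_range] at hk
    have : tripleExcess p g θ k = 0 := by
      rcases lt_or_gt_of_ne hne with hlt | hlt
      · by_contra hne'
        have h3 : 0 < tripleExcess p g θ k := lt_of_le_of_ne (le_max_left _ _) (Ne.symm hne')
        have := tripleExcess_unique hp hθ hadd (by omega) (by exact_mod_cast hlt) h2 h3
        linarith
      · exact tripleExcess_unique hp hθ hadd (by omega) (by exact_mod_cast hlt)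
          (by exact_mod_cast hk) hpos
    rw [this, mul_zero]
  · intro h
    exact absurd (Finset.mem_range.2 hrg) h

lemma reflexSum_shift {p q : ℕ} {θ : ℤ → ℝ}
    (hadd : ∀ i : ℤ, θ (i + (q : ℤ)) = θ i + 2 * Real.pi) (φ : ℝ) :
    reflexSum p q (fun i ↦ θ (i + 1)) φ = reflexSum p q θ φ := by
  have h1 := Finset.sum_range_succ (fun i : ℕ ↦ reflexTerm p θ φ i) q
  have h2 := Finset.sum_range_succ' (fun i : ℕ ↦ reflexTerm p θ φ i) q
  have h3 := reflexTerm_add_mul (p := p) hadd φ 0 1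
  rw [mul_one, zero_add] at h3
  have h4 : ∀ i : ℕ, reflexTerm p (fun i ↦ θ (i + 1)) φ i = reflexTerm p θ φ ((i + 1 : ℕ) : ℤ) := by
    intro i
    unfold reflexTerm
    push_cast
    rw [add_right_comm]
  unfold reflexSum
  rw [Finset.sum_congr rfl fun i _ ↦ h4 i]
  simp only [h3] at h1
  simp only [Nat.cast_zero] at h2
  linarith

variable {μ : Measure Plane}

/-- If a sign-reversing function `w` never vanishes where the reflex bisectors balance, there is a
convex spiral. -/
lemma exists_convex_levelFan_of_sign_reversal [μ.IsOpenPosMeasure] (hμ : IsMass μ) {p q : ℕ}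
    (hp : 2 ≤ p) (hpq : p < q) {w : ℝ × ℝ × ℝ → ℝ} (hw : Continuous w)
    (hsgn : ∀ x y, w (x, y, 1) = -w (x, y, 0))
    (hne : ∀ x y s, s ∈ Set.Icc (0 : ℝ) 1 →
      (∀ j, ∃ i, IsReflex p (levelFan μ q !₂[x, y] s) i ∧ i < j ∧ j < i + p) → w (x, y, s) ≠ 0) :
    ∃ O s θ, IsLevelFan μ q O s θ ∧ s ∈ Set.Icc (0 : ℝ) 1 ∧
      ∀ i : ℤ, θ (i + p) ≤ θ i + Real.pi := by
  by_contra! hcon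
  have := hμ.1
  have hq : 0 < q := by omega
  have hq' : (0 : ℝ) < q := by exact_mod_cast hq
  have hfan : ∀ O : Plane, ∀ s ∈ Set.Icc (0 : ℝ) 1, IsEquiFan μ q O (levelFan μ q O s) :=
    fun O s hs ↦ (hμ.isLevelFan hq O hs).isEquiFan hμ hq
  have hex : ∀ O : Plane, ∀ s ∈ Set.Icc (0 : ℝ) 1, ∃ i, IsReflex p (levelFan μ q O s) i :=
    fun O s hs ↦ hcon O s _ (hμ.isLevelFan hq O hs) hs
  obtain ⟨r, hr, hfar⟩ := exists_real_far_lt (μ := μ) (ε := 1 / q) (by positivity)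
  set R : ℝ := 2 * q * r with hR
  have hRpos : 0 < R := by positivity
  let P : ℝ × ℝ × ℝ → Plane := fun a ↦ !₂[a.1, a.2.1]
  have hP : Continuous P := by
    refine (PiLp.continuous_toLp 2 _).comp (continuous_pi fun k ↦ ?_)
    fin_cases k <;> simp <;> fun_prop
  -- A cutoff that deforms the bisector field into the identity field for `R ≤ ‖O‖ ≤ R + 1`.
  let l : ℝ × ℝ × ℝ → ℝ := fun a ↦ max 0 (min 1 (‖P a‖ - R))
  have hl : Continuous l := by fun_prop
  have hl0 : ∀ a, 0 ≤ l a := fun a ↦ le_max_left _ _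
  have hl1 : ∀ a, l a ≤ 1 := fun a ↦ max_le zero_le_one (min_le_left _ _)
  let F : ℝ → ℝ × ℝ × ℝ → ℝ := fun φ a ↦ reflexSum p q (levelFan μ q (P a) a.2.2) φ
  have hF : ∀ φ, Continuous (F φ) := by
    intro φ
    have h1 : ∀ i : ℤ, Continuous fun a : ℝ × ℝ × ℝ ↦ levelFan μ q (P a) a.2.2 i :=
      hμ.continuous_levelFan
    simp only [F, reflexSum, reflexTerm]
    refine continuous_finsetSum _ fun i _ ↦ ?_
    have h2 := h1 i
    have h3 := h1 (i + p)
    fun_prop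
  obtain ⟨x, y, s, hs, hf0, hg0, hw0⟩ := exists_zero_of_sign_reversal
    (f := fun a ↦ (1 - l a) * F 0 a + l a * a.1)
    (g := fun a ↦ (1 - l a) * F (Real.pi / 2) a + l a * a.2.1) (w := w)
    (by have := hF 0; fun_prop) (by have := hF (Real.pi / 2); fun_prop) hw
    (M := R + 1) (by linarith)
    (by
      intro x y s hs hxy
      have h1 : R + 1 ≤ ‖P (x, y, s)‖ := by
        rcases hxy with h | h
        · exact h.trans (PiLp.norm_apply_le (P (x, y, s)) 0)
        · exact h.trans (PiLp.norm_apply_le (P (x, y, s)) 1)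
      have h2 : l (x, y, s) = 1 := by
        simp only [l]
        rw [min_eq_left (by linarith), max_eq_right zero_le_one]
      simp [h2])
    (by
      intro x y
      have h1 : ∀ φ, F φ (x, y, 1) = F φ (x, y, 0) := by
        intro φ
        have h2 : levelFan μ q (P (x, y, 1)) 1 = fun i ↦ levelFan μ q (P (x, y, 0)) 0 (i + 1) :=
          funext fun i ↦ hμ.levelFan_one hq _ i
        simp only [F]
        rw [h2, reflexSum_shift (hfan _ 0 (by simp)).add]
      have h3 : l (x, y, 1) = l (x, y, 0) := rfl
      simp [h1, h3])
    hsgn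
  have hE := hfan (P (x, y, s)) s hs
  refine hne x y s hs (fun j ↦ ?_) hw0
  rcases lt_or_ge ‖P (x, y, s)‖ R with hlt | hge
  · have h1 : l (x, y, s) = 0 := by
      simp only [l]
      exact max_eq_left ((min_le_right _ _).trans (by linarith))
    simp only [h1, sub_zero, one_mul, zero_mul, add_zero] at hf0 hg0
    exact reflex_cover_of_reflexSum_eq_zero hE.strictMono hE.add hpq (hex _ s hs) hf0 hg0 j
  · exfalso
    have hne0 : P (x, y, s) ≠ 0 := by
      intro h
      rw [h, norm_zero] at hge
      linarith
    obtain ⟨ρ, hρ⟩ := exists_isPolar hne0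
    set ω := polarAngle 0 (P (x, y, s))
    -- From radius `R` on, both fields have positive component along `ω`, so their convex
    -- combination has no zero.
    have h1 := hE.reflexSum_pos hμ hp hpq hr hfar hρ (by rw [← hρ.norm_eq]; exact hge)
    have h2 : 0 < F ω (x, y, s) := h1
    have h3 : F ω (x, y, s) = F 0 (x, y, s) * Real.cos ω + F (Real.pi / 2) (x, y, s) * Real.sin ω :=
      reflexSum_eq _ _ _ _
    obtain ⟨hρ0, hx, hy⟩ := hρ
    simp [P] at hx hy
    simp only at hf0 hg0
    have h4 : (1 - l (x, y, s)) * F ω (x, y, s) + l (x, y, s) * ρ = 0 := by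
      have hc := Real.cos_sq_add_sin_sq ω
      linear_combination Real.cos ω * hf0 + Real.sin ω * hg0 + (1 - l (x, y, s)) * h3
        - l (x, y, s) * Real.cos ω * hx - l (x, y, s) * Real.sin ω * hy
        - l (x, y, s) * ρ * hc
    have h5 := hl0 (x, y, s)
    have h6 := hl1 (x, y, s)
    rcases eq_or_lt_of_le h5 with h7 | h7
    · rw [← h7] at h4
      linarith
    · have := mul_pos h7 hρ0
      have := mul_nonneg (sub_nonneg.2 h6) h2.le
      linarith

/-- A mass that charges every open set has a convex spiral in the range without obstruction. -/
lemma exists_convex_levelFan [μ.IsOpenPosMeasure] (hμ : IsMass μ) {p q : ℕ}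
    (hp : 2 ≤ p) (hpq : 2 * p ≤ q) (h : 3 * p ≤ q + 2 ∨ (3 * p = q + 3 ∧ Odd p)) :
    ∃ O s θ, IsLevelFan μ q O s θ ∧ s ∈ Set.Icc (0 : ℝ) 1 ∧
      ∀ i : ℤ, θ (i + p) ≤ θ i + Real.pi := by
  have hq : 0 < q := by omega
  have hfan : ∀ O : Plane, ∀ s ∈ Set.Icc (0 : ℝ) 1, IsEquiFan μ q O (levelFan μ q O s) :=
    fun O s hs ↦ (hμ.isLevelFan hq O hs).isEquiFan hμ hq
  rcases h with h | ⟨h, hodd⟩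
  -- Here a cover by reflex wedges is impossible, so any sign-reversing function serves.
  · refine exists_convex_levelFan_of_sign_reversal hμ hp (by omega) (w := fun a ↦ 1 - 2 * a.2.2)
      (by fun_prop) (fun x y ↦ by norm_num) fun x y s hs hcov ↦ ?_
    have hE := hfan !₂[x, y] s hs
    have := (reflex_cover hE.strictMono hE.add hpq hcov).1
    omega
  · obtain ⟨g, rfl⟩ : ∃ g, p = g + 1 := ⟨p - 1, by omega⟩
    obtain rfl : q = 3 * g := by omega
    have hg : Even g := by
      rcases hodd with ⟨k, hk⟩
      exact ⟨k, by omega⟩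
    refine exists_convex_levelFan_of_sign_reversal hμ hp (by omega)
      (w := fun a ↦ alternatingExcess (g + 1) g (levelFan μ (3 * g) !₂[a.1, a.2.1] a.2.2)) ?_ ?_ ?_
    · simp only [alternatingExcess, tripleExcess, reflexExcess]
      refine continuous_finsetSum _ fun i _ ↦ ?_
      have h1 := fun i ↦ hμ.continuous_levelFan (q := 3 * g) i
      have a1 := h1 i
      have a2 := h1 (i + (g + 1 : ℕ))
      have a3 := h1 (i + g)
      have a4 := h1 (i + g + (g + 1 : ℕ))
      have a5 := h1 (i + 2 * g)
      have a6 := h1 (i + 2 * g + (g + 1 : ℕ))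
      fun_prop
    · intro x y
      have hE := hfan !₂[x, y] 0 (by simp)
      rw [alternatingExcess, alternatingExcess,
        ← sum_alternating_shift hg (tripleExcess_periodic hE.add)]
      refine Finset.sum_congr rfl fun i _ ↦ ?_
      congr 1
      simp only [tripleExcess, reflexExcess, hμ.levelFan_one hq]
      ring_nf
    · intro x y s hs hcov
      have hE := hfan !₂[x, y] s hs
      refine alternatingExcess_ne_zero rfl (by omega) hE.strictMono hE.add ?_
      exact (reflex_cover hE.strictMono hE.add hpq hcov).2 (by push_cast; ring)

end SpiralEquicovering

/-! ### Arbitrary masses by approximation and compactness. -/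

namespace SpiralEquicovering

/-- A mass that charges every nonempty open set. -/
noncomputable def fullMass : Measure Plane := (volume : Measure Plane).toFinite

lemma isMass_fullMass : IsMass fullMass :=
  ⟨inferInstanceAs (IsProbabilityMeasure (volume : Measure Plane).toFinite), fun _ hL ↦
    toFinite_absolutelyContinuous _ (volume_line hL)⟩

/-- The mixture of a mass with `fullMass`. -/
noncomputable def mixture (μ : Measure Plane) (ε : ℝ) : Measure Plane :=
  ENNReal.ofReal (1 - ε) • μ + ENNReal.ofReal ε • fullMass

variable {μ : Measure Plane} {p q : ℕ}

lemma IsMass.measureReal_mixture (hμ : IsMass μ) {ε : ℝ} (h0 : 0 ≤ ε) (h1 : ε ≤ 1)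
    (S : Set Plane) : (mixture μ ε).real S = (1 - ε) * μ.real S + ε * fullMass.real S := by
  have := hμ.1
  have := isMass_fullMass.1
  simp only [mixture, measureReal_def, Measure.add_apply, Measure.smul_apply, smul_eq_mul]
  rw [ENNReal.toReal_add (by finiteness) (by finiteness), ENNReal.toReal_mul, ENNReal.toReal_mul,
    ENNReal.toReal_ofReal (by linarith), ENNReal.toReal_ofReal h0]

lemma IsMass.angularMass_mixture (hμ : IsMass μ) {ε : ℝ} (h0 : 0 ≤ ε) (h1 : ε ≤ 1) (O : Plane)
    (t : ℝ) : angularMass (mixture μ ε) O t =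
      (1 - ε) * angularMass μ O t + ε * angularMass fullMass O t :=
  hμ.measureReal_mixture h0 h1 _

lemma IsMass.isMass_mixture (hμ : IsMass μ) {ε : ℝ} (h0 : 0 ≤ ε) (h1 : ε ≤ 1) :
    IsMass (mixture μ ε) := by
  have := hμ.1
  have := isMass_fullMass.1
  refine ⟨⟨?_⟩, fun L hL ↦ ?_⟩
  · simp only [mixture, Measure.add_apply, Measure.smul_apply, smul_eq_mul, measure_univ, mul_one]
    rw [← ENNReal.ofReal_add (by linarith) h0]
    simp
  · simp [mixture, hμ.2 L hL, isMass_fullMass.2 L hL]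

lemma isOpenPosMeasure_mixture (μ : Measure Plane) {ε : ℝ} (h0 : 0 < ε) :
    (mixture μ ε).IsOpenPosMeasure := by
  refine Measure.AbsolutelyContinuous.isOpenPosMeasure (μ := (volume : Measure Plane)) ?_
  refine Measure.AbsolutelyContinuous.mk fun S _ hS ↦ ?_
  simp only [mixture, Measure.add_apply, Measure.smul_apply, smul_eq_mul, add_eq_zero, mul_eq_zero,
    ENNReal.ofReal_eq_zero] at hS
  exact absolutelyContinuous_toFinite _ (hS.2.resolve_left (not_le.2 h0))

/-- The half-plane through a far centre facing away from the origin misses the ball of radius `r`,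
yet a convex spiral gives it mass at least `(p - 1) / q ≥ 1 / q`. -/
lemma norm_lt_of_far_lt {O : Plane} {θ : ℤ → ℝ} {r : ℝ} (hμ : IsMass μ)
    (h : IsEquiFan μ q O θ) (hp : 2 ≤ p) (hpq : p < q)
    (hconv : ∀ i : ℤ, θ (i + p) ≤ θ i + Real.pi) (hr : 0 < r)
    (hfar : μ.real {x | r ≤ ‖x‖} < 1 / q) : ‖O‖ < r := by
  have := hμ.1
  have hq' : (0 : ℝ) < q := by exact_mod_cast (by omega : 0 < q)
  by_contra! hle
  have hne : O ≠ 0 := by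
    rintro rfl
    rw [norm_zero] at hle
    linarith
  obtain ⟨R, hR⟩ := exists_isPolar hne
  set ω := polarAngle 0 O
  have hRr : r ≤ R := hR.norm_eq ▸ hle
  have hsub : sweep O (ω - Real.pi / 2) (ω - Real.pi / 2 + Real.pi) ⊆ {x | r ≤ ‖x‖} := by
    intro x hx
    rw [mem_halfPlane_iff, lineSide, Real.cos_sub_pi_div_two, Real.sin_sub_pi_div_two] at hx
    obtain ⟨-, h0, h1⟩ := hR
    simp only [PiLp.zero_apply, sub_zero] at h0 h1
    have h2 := coord_le_norm x ω
    rw [h0, h1] at hx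
    have h3 := Real.cos_sq_add_sin_sq ω
    have h4 : x 0 * Real.cos ω + x 1 * Real.sin ω - R =
        Real.sin ω * (x 1 - R * Real.sin ω) - -Real.cos ω * (x 0 - R * Real.cos ω) := by
      linear_combination R * h3
    simp only [Set.mem_ofPred_eq]
    linarith
  have h1 := h.le_measureReal_halfPlane hμ (by omega) hpq hconv (ω - Real.pi / 2)
  have h2 := measureReal_mono (μ := μ) hsub
  have h3 : 1 / (q : ℝ) ≤ ((p : ℝ) - 1) / q := by
    have : (2 : ℝ) ≤ p := by exact_mod_cast hp
    gcongr
    linarith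
  linarith

lemma IsMass.tendsto_angularMass (hμ : IsMass μ) {u : ℕ → Plane} {v : ℕ → ℝ} {O : Plane} {t : ℝ}
    (hu : Tendsto u atTop (𝓝 O)) (hv : Tendsto v atTop (𝓝 t)) :
    Tendsto (fun n ↦ angularMass μ (u n) (v n)) atTop (𝓝 (angularMass μ O t)) := by
  have hp : Tendsto (fun n ↦ (u n, v n)) atTop (𝓝 (O, t)) := hu.prodMk_nhds hv
  have h : Tendsto (fun p : Plane × ℝ ↦ angularMass μ p.1 p.2) (𝓝 (O, t))
      (𝓝 (angularMass μ O t)) := hμ.continuous_angularMass.tendsto' _ _ rfl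
  simpa only [Function.comp_def] using h.comp hp

/-- Convex level fans with bounded centres for mixtures that tend to `μ` subconverge to a convex
level fan for `μ`. -/
lemma IsMass.exists_convex_levelFan_of_mixture (hμ : IsMass μ) (hq : 0 < q) {ε : ℕ → ℝ} {r : ℝ}
    (hε0 : ∀ n, 0 < ε n) (hε1 : ∀ n, ε n ≤ 1) (hεlim : Tendsto ε atTop (𝓝 0))
    {a : ℕ → Plane × ℝ × (ℤ → ℝ)}
    (hfan : ∀ n, IsLevelFan (mixture μ (ε n)) q (a n).1 (a n).2.1 (a n).2.2)
    (hs : ∀ n, (a n).2.1 ∈ Set.Icc (0 : ℝ) 1)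
    (hconv : ∀ n, ∀ i : ℤ, (a n).2.2 (i + p) ≤ (a n).2.2 i + Real.pi)
    (hnorm : ∀ n, ‖(a n).1‖ < r) :
    ∃ O s θ, IsLevelFan μ q O s θ ∧ ∀ i : ℤ, θ (i + p) ≤ θ i + Real.pi := by
  have := hμ.1
  have hqz : (0 : ℤ) < q := by exact_mod_cast hq
  -- Centres, phases and lifted angles all stay in compact sets; convergence of the angles is only
  -- required index by index.
  let K : Set (Plane × ℝ × (ℤ → ℝ)) := Metric.closedBall 0 r ×ˢ Set.Icc (0 : ℝ) 1 ×ˢ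
    Set.univ.pi fun i : ℤ ↦ Set.Icc (-Real.pi + 2 * Real.pi * (i / q : ℤ))
      (Real.pi + 2 * Real.pi * (i / q : ℤ))
  have hK : IsCompact K :=
    (isCompact_closedBall _ _).prod (isCompact_Icc.prod (isCompact_univ_pi fun _ ↦ isCompact_Icc))
  have haK : ∀ n, a n ∈ K := by
    intro n
    refine ⟨by simpa using (hnorm n).le, hs n, fun i _ ↦ ?_⟩
    have h1 := (hfan n).mem (i % q) (Int.emod_nonneg i hqz.ne') (Int.emod_lt_of_pos i hqz)
    have h2 := add_int_mul_of_add (hfan n).add (i % q) (i / q)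
    rw [Int.emod_add_mul_ediv] at h2
    rw [h2]
    exact ⟨by linarith [h1.1], by linarith [h1.2]⟩
  obtain ⟨⟨O, s, θ⟩, hmem, φ, hφ, hlim⟩ := hK.tendsto_subseq haK
  have hO : Tendsto (fun n ↦ (a (φ n)).1) atTop (𝓝 O) := (continuous_fst.tendsto _).comp hlim
  have hS : Tendsto (fun n ↦ (a (φ n)).2.1) atTop (𝓝 s) :=
    ((continuous_fst.comp continuous_snd).tendsto _).comp hlim
  have hΘ : ∀ i, Tendsto (fun n ↦ (a (φ n)).2.2 i) atTop (𝓝 (θ i)) := fun i ↦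
    (((continuous_apply i).comp (continuous_snd.comp continuous_snd)).tendsto _).comp hlim
  have hεφ : Tendsto (fun n ↦ ε (φ n)) atTop (𝓝 0) := hεlim.comp hφ.tendsto_atTop
  refine ⟨O, s, θ, ⟨fun i ↦ ?_, fun i h1 h2 ↦ ?_, fun i h1 h2 ↦ ?_⟩, fun i ↦ ?_⟩
  · refine tendsto_nhds_unique (hΘ (i + q)) ?_
    simp_rw [fun n ↦ (hfan (φ n)).add i]
    exact (hΘ i).add_const _
  · exact isClosed_Icc.mem_of_tendsto (hΘ i) (Eventually.of_forall fun n ↦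
      (hfan (φ n)).mem i h1 h2)
  · have hcont : ∀ {ν : Measure Plane}, IsMass ν →
        Tendsto (fun n ↦ angularMass ν (a (φ n)).1 ((a (φ n)).2.2 i)) atTop
          (𝓝 (angularMass ν O (θ i))) := fun hν' ↦
      hν'.tendsto_angularMass hO (hΘ i)
    have hl := ((hεφ.const_sub 1).mul (hcont hμ)).add (hεφ.mul (hcont isMass_fullMass))
    rw [sub_zero, one_mul, zero_mul, add_zero] at hl
    have hr' : Tendsto (fun n ↦ ((i : ℝ) + (a (φ n)).2.1) / q) atTop (𝓝 ((i + s) / q)) :=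
      (hS.const_add _).div_const _
    refine tendsto_nhds_unique hl (hr'.congr fun n ↦ ?_)
    exact ((hfan (φ n)).mass i h1 h2).symm.trans
      (hμ.angularMass_mixture (hε0 (φ n)).le (hε1 (φ n)) _ _)
  · exact le_of_tendsto_of_tendsto' (hΘ (i + p)) ((hΘ i).add_const _) fun n ↦ hconv (φ n) i

/-- Every mass has a convex spiral in the range without obstruction. -/
lemma IsMass.exists_convex_levelFan (hμ : IsMass μ) (hp : 2 ≤ p) (hpq : 2 * p ≤ q)
    (h : 3 * p ≤ q + 2 ∨ (3 * p = q + 3 ∧ Odd p)) :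
    ∃ O s θ, IsLevelFan μ q O s θ ∧ ∀ i : ℤ, θ (i + p) ≤ θ i + Real.pi := by
  have := hμ.1
  have := isMass_fullMass.1
  have hq : 0 < q := by omega
  have hqz : (0 : ℤ) < q := by exact_mod_cast hq
  have hq' : (1 : ℝ) ≤ q := by exact_mod_cast hq
  -- With `ε n ≤ 1 / (2q)` and far `μ`-mass below `1 / (2q)`, every mixture has far mass below `1 /
  -- q`, which bounds all centres by one `r`.
  let ε : ℕ → ℝ := fun n ↦ 1 / (2 * q) * (1 / ((n : ℝ) + 1))
  have hε0 : ∀ n, 0 < ε n := fun n ↦ by positivity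
  have hεq : ∀ n, ε n ≤ 1 / (2 * q) := fun n ↦ by
    refine mul_le_of_le_one_right (by positivity) ?_
    rw [div_le_one (by positivity)]
    linarith [(Nat.cast_nonneg n : (0 : ℝ) ≤ n)]
  have hε1 : ∀ n, ε n ≤ 1 := fun n ↦ (hεq n).trans (by rw [div_le_one (by positivity)]; linarith)
  have hεlim : Tendsto ε atTop (𝓝 0) := by
    have := (tendsto_one_div_add_atTop_nhds_zero_nat (𝕜 := ℝ)).const_mul (1 / (2 * (q : ℝ)))
    rwa [mul_zero] at this
  have hν : ∀ n, IsMass (mixture μ (ε n)) := fun n ↦ hμ.isMass_mixture (hε0 n).le (hε1 n)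
  have hexn : ∀ n, ∃ a : Plane × ℝ × (ℤ → ℝ), IsLevelFan (mixture μ (ε n)) q a.1 a.2.1 a.2.2 ∧
      a.2.1 ∈ Set.Icc (0 : ℝ) 1 ∧ ∀ i : ℤ, a.2.2 (i + p) ≤ a.2.2 i + Real.pi := by
    intro n
    have := isOpenPosMeasure_mixture μ (hε0 n)
    obtain ⟨O, s, θ, hfan⟩ := SpiralEquicovering.exists_convex_levelFan (hν n) hp hpq h
    exact ⟨⟨O, s, θ⟩, hfan⟩
  choose a hfan hs hconv using hexn
  obtain ⟨r, hr, hfar⟩ := exists_real_far_lt (μ := μ) (ε := 1 / (2 * q)) (by positivity)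
  have hnorm : ∀ n, ‖(a n).1‖ < r := by
    intro n
    refine norm_lt_of_far_lt (hν n) ((hfan n).isEquiFan (hν n) hq) hp (by omega) (hconv n) hr ?_
    rw [hμ.measureReal_mixture (hε0 n).le (hε1 n)]
    have h1 : (1 - ε n) * μ.real {x | r ≤ ‖x‖} ≤ μ.real {x | r ≤ ‖x‖} :=
      mul_le_of_le_one_left measureReal_nonneg (by linarith [hε0 n])
    have h2 : ε n * fullMass.real {x | r ≤ ‖x‖} ≤ ε n :=
      mul_le_of_le_one_right (hε0 n).le measureReal_le_one
    have h3 : 1 / (q : ℝ) = 1 / (2 * q) + 1 / (2 * q) := by field_simp; norm_num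
    linarith [hεq n]
  exact hμ.exists_convex_levelFan_of_mixture hq hε0 hε1 hεlim hfan hs hconv hnorm

lemma IsMass.admits (hμ : IsMass μ) (hp : 2 ≤ p) (hpq : 2 * p ≤ q)
    (h : 3 * p ≤ q + 2 ∨ (3 * p = q + 3 ∧ Odd p)) : AdmitsSpiralEquicovering μ q p := by
  obtain ⟨O, s, θ, hfan, hconv⟩ := hμ.exists_convex_levelFan hp hpq h
  exact (hfan.isEquiFan hμ (by omega)).admits hμ (by omega) (by omega) hconv

/-- The existence argument needs `p ≥ 2`; keeping every second ray of a fan for `(2q, 2)` supplies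
`p = 1`. -/
lemma IsMass.admits_one (hμ : IsMass μ) (hq : 3 ≤ q) : AdmitsSpiralEquicovering μ q 1 := by
  obtain ⟨O, s, θ, hlev, hconv⟩ := hμ.exists_convex_levelFan (p := 2) (q := 2 * q) le_rfl
    (by omega) (Or.inl (by omega))
  have hfan := hlev.isEquiFan hμ (by omega)
  have hq' : (q : ℝ) ≠ 0 := by
    have : 0 < q := by omega
    positivity
  have hfan' : IsEquiFan μ q O fun i ↦ θ (2 * i) := by
    refine ⟨fun i j hij ↦ hfan.strictMono (by omega), fun i ↦ ?_, fun i ↦ ?_⟩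
    · rw [← hfan.add]
      push_cast
      ring_nf
    · have := hfan.measureReal_sweep hμ (2 * i) (k := 2) (by omega)
      rw [mul_add, mul_one]
      push_cast at this
      rw [this]
      field_simp
  refine hfan'.admits hμ one_pos (by omega) fun i ↦ ?_
  have := hconv (2 * i)
  push_cast at this ⊢
  rwa [mul_add, mul_one]

end SpiralEquicovering

theorem theorem1 (p q : ℕ) (hp : 0 < p) (hpq : p < q) (hcop : Nat.Coprime p q) :
    (q < 2 * p →
      (∃ μ : MeasureTheory.Measure SpiralEquicovering.Plane, SpiralEquicovering.IsMass μ ∧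
        ¬ SpiralEquicovering.AdmitsSpiralEquicovering μ q p) ∧
      ∀ μ : MeasureTheory.Measure SpiralEquicovering.Plane, SpiralEquicovering.IsMass μ →
        ¬ SpiralEquicovering.AdmitsSpiralEquicovering μ q p) ∧
    ((q : ℤ) < 3 * p - 3 →
      ∃ μ : MeasureTheory.Measure SpiralEquicovering.Plane, SpiralEquicovering.IsMass μ ∧
        ¬ SpiralEquicovering.AdmitsSpiralEquicovering μ q p) ∧
    ((q : ℤ) = 3 * p - 3 → Odd p →
      ∀ μ : MeasureTheory.Measure SpiralEquicovering.Plane, SpiralEquicovering.IsMass μ →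
        SpiralEquicovering.AdmitsSpiralEquicovering μ q p) ∧
    ((3 * p - 3 : ℤ) < q → q < 3 * p → 2 ≤ p →
      ∀ μ : MeasureTheory.Measure SpiralEquicovering.Plane, SpiralEquicovering.IsMass μ →
        SpiralEquicovering.AdmitsSpiralEquicovering μ q p) ∧
    (3 * p ≤ q →
      ∀ μ : MeasureTheory.Measure SpiralEquicovering.Plane, SpiralEquicovering.IsMass μ →
        SpiralEquicovering.AdmitsSpiralEquicovering μ q p) := by
  refine ⟨fun h ↦ ⟨?_, fun μ hμ ↦ SpiralEquicovering.not_admits_of_lt_two_mul hμ hp hpq hcop h⟩,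
    fun h ↦ SpiralEquicovering.exists_isMass_not_admits hp hpq hcop h, fun h hodd μ hμ ↦ ?_,
    fun h _ hp2 μ hμ ↦ hμ.admits hp2 (by omega) (Or.inl (by omega)), fun h μ hμ ↦ ?_⟩
  · exact ⟨_, SpiralEquicovering.isMass_fullMass,
      SpiralEquicovering.not_admits_of_lt_two_mul SpiralEquicovering.isMass_fullMass hp hpq hcop h⟩
  · obtain ⟨k, hk⟩ := hodd
    exact hμ.admits (by omega) (by omega) (Or.inr ⟨by omega, k, hk⟩)
  · rcases (show p = 1 ∨ 2 ≤ p by omega) with rfl | hp2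
    · exact hμ.admits_one (by omega)
    · exact hμ.admits hp2 (by omega) (Or.inl (by omega))
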